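/- Let $k=\mathbb{F}_q$ be a finite field, let $g\ge 1$, and let $f,h\in k[x]$ with $f$ monic, $\deg f=2g+1$, $\deg h\le g$, such that the affine curve $y^2+h(x)y=f(x)$ is smooth over $k$. Let $C$ be the smooth projective curve with this affine equation (the normalization of $\mathbb{P}^1$ in the affine curve via $(x,y)\mapsto[x:1]$), i.e. a hyperelliptic curve of genus $g$ (elliptic curves are included), and let $\pi:C\to\mathbb{P}^1$ be the resulting double cover $(x,y)\mapsto [x:1]$. Write $|X|$ for the set of closed points of $X$, $\deg(x)=[k(x):k]$ for the degree of a closed point, and $$Z(C,t)=\exp\Big(\sum_{n\ge 1}\frac{\#C(\mathbb{F}_{q^n})}{n}t^n\Big)\in\mathbb{Q}[[t]].$$ For $x\in|\mathbb{P}^1|$ and $y\in|C|$ with $\pi(y)=x$, let $e(y\mid x)$ be the ramification index and $f(y\mid x)=[k(y):k(x)]$ the inertia degree. Call $x$ ramified if $e(y\mid x)>1$ for some $y\in\pi^{-1}(x)$, split if $e(y\mid x)=f(y\mid x)=1$ for all $y\in\pi^{-1}(x)$, and inert if $x$ is not ramified and $\pi^{-1}(x)$ consists of a single closed point. Put $Z_x(C,t)=\prod_{y\in\pi^{-1}(x)}(1-t^{\deg(y)})^{-1}$.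 Then $$Z(C,t)=\prod_{x\in|\mathbb{P}^1|}Z_x(C,t)$$ as a formal infinite product in $\mathbb{Q}[[t]]$; every $x\in|\mathbb{P}^1|$ is exactly one of ramified, split, inert; and $$Z_x(C,t)=\begin{cases}\dfrac{1}{1-t^{\deg(x)}},&x\text{ ramified},\\[1em]\dfrac{1}{(1-t^{\deg(x)})^2},&x\text{ split},\\[1em]\dfrac{1}{1-t^{2\deg(x)}},&x\text{ inert}.\end{cases}$$ -/

import Mathlib

open CategoryTheory AlgebraicGeometry

universe u

noncomputable section

namespace HyperellipticZeta

/-! ### Zeta functions of schemes over a finite field -/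

section Zeta

variable {k : Type u} [Field k] {X : Scheme.{u}}

/-- The degree `[κ(x) : k]` of a point `x` of a `k`-scheme `s : X ⟶ Spec k`. -/
def pointDegree (s : X ⟶ Spec (.of k)) (x : X) : ℕ :=
  s.residueDegree x

variable (k) in
/-- The extension of degree `n ≥ 1` of a finite field `k` with `q` elements, as the splitting
field of `T ^ (q ^ n) - T` over `k`. -/
abbrev FiniteExtension (n : ℕ) : Type u :=
  Polynomial.SplittingField
    (Polynomial.X ^ (Nat.card k ^ n) - Polynomial.X : Polynomial k)

/-- The number of points of the `k`-scheme `s : X ⟶ Spec k` with values in the extension of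
degree `n` of the finite field `k`. -/
def pointCount (s : X ⟶ Spec (.of k)) (n : ℕ) : ℕ :=
  Nat.card {p : Spec (.of (FiniteExtension k n)) ⟶ X //
    p ≫ s = Spec.map (CommRingCat.ofHom (algebraMap k (FiniteExtension k n)))}

/-- The zeta function `exp (∑_{n ≥ 1} #X(𝔽_{q ^ n}) t ^ n / n)` as a formal power series.
(The coefficient at `n = 0` of the series in the exponent is a division by zero, that is `0`.) -/
def zetaFunction (s : X ⟶ Spec (.of k)) : PowerSeries ℚ :=
  (PowerSeries.exp ℚ).subst
    (PowerSeries.mk fun n : ℕ => (pointCount s n : ℚ) / (n : ℚ))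

end Zeta

open scoped PowerSeries.WithPiTopology in
/-- `a` is the formal infinite product of the family of power series `F`: every coefficient of
the finite partial products is eventually equal to that of `a` (the coefficient ring carries the
discrete topology). -/
def HasFormalProd {ι : Type*} {R : Type*} [CommRing R] (F : ι → PowerSeries R)
    (a : PowerSeries R) : Prop :=
  letI : TopologicalSpace R := ⊥
  HasProd F a

/-! ### The projective line -/

section ProjectiveLine

variable (k : Type u) [Field k]

/-- The standard grading of `k[X₀, X₁]`. -/
abbrev grading : ℕ → Submodule k (MvPolynomial (Fin 2) k) :=
  MvPolynomial.homogeneousSubmodule (Fin 2) k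

instance : GradedAlgebra (grading k) :=
  MvPolynomial.gradedAlgebra

/-- The projective line over `k`. -/
def ProjectiveLine : Scheme.{u} :=
  Proj (grading k)

/-- The structure morphism of the projective line over `k`. -/
def ProjectiveLine.structureMap : ProjectiveLine k ⟶ Spec (.of k) :=
  Proj.toSpecZero (grading k) ≫
    Spec.map (CommRingCat.ofHom (algebraMap k (grading k 0)))

/-- The ring homomorphism from the degree zero part of `k[X₀, X₁, X₁⁻¹]` to `k[x]` with
`X₀ / X₁ ↦ x`. -/
def ProjectiveLine.chartRingHom :
    HomogeneousLocalization.Away (grading k) (MvPolynomial.X 1) →+* Polynomial k :=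
  (IsLocalization.Away.lift (S := Localization.Away (MvPolynomial.X 1 : MvPolynomial (Fin 2) k))
    (MvPolynomial.X 1 : MvPolynomial (Fin 2) k)
    (g := (MvPolynomial.aeval (R := k) ![(Polynomial.X : Polynomial k), 1]).toRingHom)
    (by simp)).comp
  (algebraMap (HomogeneousLocalization.Away (grading k) (MvPolynomial.X 1))
    (Localization.Away (MvPolynomial.X 1 : MvPolynomial (Fin 2) k)))

/-- The standard chart `x ↦ [x : 1]` from the affine line to the projective line. -/
def ProjectiveLine.chart : Spec (.of (Polynomial k)) ⟶ ProjectiveLine k :=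
  Spec.map (CommRingCat.ofHom (ProjectiveLine.chartRingHom k)) ≫
    Proj.awayι (grading k) (MvPolynomial.X 1)
      (MvPolynomial.isHomogeneous_X k 1) Nat.one_pos

end ProjectiveLine

/-! ### Hyperelliptic curves -/

section Curve

variable {k : Type u} [Field k] (f h : Polynomial k)

/-- The coordinate ring `k[x, y] / (y ^ 2 + h(x) y - f(x))`. -/
abbrev CoordinateRing : Type u :=
  AdjoinRoot (Polynomial.X ^ 2 + Polynomial.C h * Polynomial.X - Polynomial.C f :
    Polynomial (Polynomial k))

/-- The morphism `(x, y) ↦ [x : 1]` from the affine curve `y ^ 2 + h(x) y = f(x)` to the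
projective line. -/
def affineToLine : Spec (.of (CoordinateRing f h)) ⟶ ProjectiveLine k :=
  Spec.map (CommRingCat.ofHom (algebraMap (Polynomial k) (CoordinateRing f h))) ≫
    ProjectiveLine.chart k

instance : IsAffineHom (affineToLine f h) := by
  have : (ProjectiveLine k).IsSeparated := inferInstanceAs (Proj (grading k)).IsSeparated
  exact MorphismProperty.of_postcomp @IsAffineHom (affineToLine f h)
    (Limits.terminal.from (ProjectiveLine k))
    (inferInstance : IsSeparated (Limits.terminal.from (ProjectiveLine k)))
    (isAffineHom_of_isAffine _)

/-- The complete curve with affine equation `y ^ 2 + h(x) y = f(x)`: the normalization of the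
projective line in the affine curve. Over the affine line this is the affine curve itself, as `y`
is integral over `k[x]`. When the affine curve is smooth and `f` has odd degree `2 g + 1` with
`deg h ≤ g`, this is the smooth projective curve that contains it as a dense open subscheme,
with one point added at infinity. -/
def HyperellipticCurve : Scheme.{u} :=
  (affineToLine f h).normalization

/-- The double cover `π : C ⟶ ℙ¹` given by `(x, y) ↦ [x : 1]`. -/
def HyperellipticCurve.cover : HyperellipticCurve f h ⟶ ProjectiveLine k :=
  (affineToLine f h).fromNormalization

/-- The structure morphism of `C` over `k`. -/
def HyperellipticCurve.structureMap : HyperellipticCurve f h ⟶ Spec (.of k) :=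
  HyperellipticCurve.cover f h ≫ ProjectiveLine.structureMap k

end Curve

/-! ### Splitting types and local factors -/

section Splitting

variable {X Y : Scheme.{u}} (π : X ⟶ Y)

/-- The ramification index `e(y | π y)` of `π` at `y`: the one of the maximal ideal of
`𝒪_{X, y}` over `𝒪_{Y, π y}`. -/
def ramificationIndex (y : X) : ℕ :=
  letI := (π.stalkMap y).hom.toAlgebra
  (IsLocalRing.maximalIdeal (X.presheaf.stalk y)).ramificationIdx (Y.presheaf.stalk (π y))

/-- The inertia degree `f(y | π y) = [κ(y) : κ(π y)]`. -/
def inertiaDegree (y : X) : ℕ :=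
  π.residueDegree y

/-- The closed points of `X` above `x`. -/
def closedFiber (x : Y) : Set X :=
  {y | y ∈ closedPoints X ∧ π y = x}

/-- `x` is ramified: some point above `x` has ramification index `> 1`. -/
def IsRamified (x : Y) : Prop :=
  ∃ y ∈ closedFiber π x, 1 < ramificationIndex π y

/-- `x` is split: every point above `x` has ramification index and inertia degree `1`. -/
def IsSplit (x : Y) : Prop :=
  ∀ y ∈ closedFiber π x, ramificationIndex π y = 1 ∧ inertiaDegree π y = 1

/-- `x` is inert: `x` is not ramified and there is a single closed point above `x`. -/
def IsInert (x : Y) : Prop :=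
  ¬ IsRamified π x ∧ ∃! y, y ∈ closedFiber π x

/-- The local factor at `x` of the zeta function of the `k`-scheme `s : X ⟶ Spec k`, relative to
`π : X ⟶ Y`: the product of `1 / (1 - t ^ deg y)` over the closed points `y` above `x`. -/
def localFactor {k : Type u} [Field k] (s : X ⟶ Spec (.of k)) (x : Y) : PowerSeries ℚ :=
  ∏ᶠ y ∈ closedFiber π x, (1 - PowerSeries.X ^ pointDegree s y)⁻¹

end Splitting

end HyperellipticZeta

end

/-! The Euler product holds for any compact scheme locally of finite type over `k = 𝔽_q`. A point
with values in `𝔽_{q^n}` is a point `y` together with a `k`-embedding of `κ(y)` into `𝔽_{q^n}`.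
There are `deg y` such embeddings if `deg y ∣ n` and none otherwise, so `N_n = ∑_{deg y ∣ n} deg y`.
Hence `exp (∑ N_n tⁿ / n)` and `∏ (1 - t ^ deg y)⁻¹` have the same logarithmic derivative and the
same constant term (`hasFormalProd_exp_subst`, `hasFormalProd_zetaFunction`). Grouping the factors
along the finite fibres of `π` gives the product of local factors (`HasFormalProd.of_fibers`).

The trichotomy and the local factors follow from `∑ e f = 2` over each closed point: the only
solutions are one point with `(e, f) = (2, 1)`, one with `(1, 2)`, or two with `(1, 1)`; moreover
`deg y = f · deg x` (`splitting_of_fiber`). The identity `∑ e f = 2` holds because `π` is finite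
flat of rank 2 on the two standard charts of `ℙ¹`.

For this rank, the normalization is computed on each chart as an integral closure with a basis `1,
v`. On the chart with coordinate `x` it is the whole coordinate ring, with `v = y`. At infinity put
`X = 1 / x` and `v = y / x ^ (g + 1)`; the degree conditions on `f` and `h` turn the equation into
`v ^ 2 + X H v = X F` with `F(0) = 1`. This equation is of Eisenstein type at `X`, so `k[X] + k[X]
v` is already integrally closed in its localization at `X`
(`hasQuadraticIntegralClosure_of_localization`). -/

namespace HyperellipticZeta

/-! ### Formal power series: logarithmic derivatives and Euler products -/

section Series

open PowerSeries

/-- The equation `F' = L F` is a recursion: `(n + 1) F_{n+1}` is a sum of products `L_i F_j` with `i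
+ j = n`. Only the first `N` coefficients of the logarithmic derivative enter up to degree `N`,
which is why a finite partial product can be compared with the zeta function. -/
theorem coeff_eq_of_derivative_eq_mul {F G L M : PowerSeries ℚ} {N : ℕ}
    (h0 : constantCoeff F = constantCoeff G)
    (hF : PowerSeries.derivative ℚ F = L * F) (hG : PowerSeries.derivative ℚ G = M * G)
    (hLM : ∀ n < N, coeff n L = coeff n M) :
    ∀ n ≤ N, coeff n F = coeff n G := by
  intro n
  induction n using Nat.strong_induction_on with
  | _ n ih =>
    intro hn
    rcases n with _ | n
    · simpa using h0
    · have h1 := congrArg (coeff n) hF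
      have h2 := congrArg (coeff n) hG
      rw [coeff_derivative, coeff_mul] at h1 h2
      have h3 : ∑ p ∈ Finset.HasAntidiagonal.antidiagonal n, coeff p.1 L * coeff p.2 F =
          ∑ p ∈ Finset.HasAntidiagonal.antidiagonal n, coeff p.1 M * coeff p.2 G := by
        refine Finset.sum_congr rfl fun p hp => ?_
        have hp' := Finset.HasAntidiagonal.mem_antidiagonal.mp hp
        rw [hLM p.1 (by lia), ih p.2 (by lia) (by lia)]
      have h4 : coeff (n + 1) F * ((n : ℚ) + 1) = coeff (n + 1) G * ((n : ℚ) + 1) := by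
        rw [h1, h2, h3]
      exact mul_right_cancel₀ (by positivity) h4

/-- The series whose coefficient of `t ^ n` is `d` if `d` divides `n + 1` and `0` otherwise; it is
the logarithmic derivative of `(1 - t ^ d)⁻¹`. -/
noncomputable def logDerivSeries (d : ℕ) : PowerSeries ℚ :=
  PowerSeries.mk fun n => if d ∣ n + 1 then (d : ℚ) else 0

theorem logDerivSeries_mul {d : ℕ} (hd : 1 ≤ d) :
    logDerivSeries d * (1 - X ^ d) = C (d : ℚ) * X ^ (d - 1) := by
  ext n
  rw [mul_sub, mul_one, map_sub, coeff_mul_X_pow', coeff_C_mul, coeff_X_pow]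
  simp only [logDerivSeries, coeff_mk]
  rcases lt_or_ge n d with h | h
  · rw [if_neg (not_le.mpr h), sub_zero]
    by_cases hn : n = d - 1
    · have : n + 1 = d := by lia
      simp [hn, show d - 1 + 1 = d by lia]
    · have : ¬ d ∣ n + 1 := fun hdvd => by
        have := Nat.le_of_dvd (by lia) hdvd
        lia
      simp [hn, this]
  · have h1 : n + 1 = (n - d + 1) + d := by lia
    have h2 : n ≠ d - 1 := by lia
    have h3 : d ∣ n + 1 ↔ d ∣ n - d + 1 := by
      rw [h1]; exact (Nat.dvd_add_left dvd_rfl)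
    simp [h, h2, h3]

theorem derivative_one_sub_X_pow_inv {d : ℕ} (hd : 1 ≤ d) :
    PowerSeries.derivative ℚ ((1 - X ^ d : PowerSeries ℚ)⁻¹) =
      logDerivSeries d * (1 - X ^ d : PowerSeries ℚ)⁻¹ := by
  have hc : constantCoeff (1 - X ^ d : PowerSeries ℚ) ≠ 0 := by
    simp [show d ≠ 0 by lia]
  have h1 : (1 - X ^ d : PowerSeries ℚ) * (1 - X ^ d)⁻¹ = 1 := PowerSeries.mul_inv_cancel _ hc
  have h2 := congrArg (PowerSeries.derivative ℚ) h1
  rw [Derivation.leibniz] at h2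
  simp only [smul_eq_mul, map_sub, Derivation.leibniz_pow, Derivation.map_one_eq_zero,
    derivative_X] at h2
  have h3 := logDerivSeries_mul hd
  have h4 : C (d : ℚ) = (d : PowerSeries ℚ) := by simp
  have h5 : (1 - X ^ d : PowerSeries ℚ) ≠ 0 := fun h => by simp [h] at hc
  refine mul_left_cancel₀ h5 ?_
  rw [h4] at h3
  simp only [nsmul_eq_mul] at h2
  linear_combination h2 - (1 - X ^ d : PowerSeries ℚ)⁻¹ * h3

theorem derivative_prod_one_sub_X_pow_inv {ι : Type*} (d : ι → ℕ) (s : Finset ι)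
    (hd : ∀ i, 1 ≤ d i) :
    PowerSeries.derivative ℚ (∏ i ∈ s, (1 - X ^ d i : PowerSeries ℚ)⁻¹) =
      (∑ i ∈ s, logDerivSeries (d i)) * ∏ i ∈ s, (1 - X ^ d i : PowerSeries ℚ)⁻¹ := by
  classical
  induction s using Finset.induction_on with
  | empty => simp
  | insert a s ha ih =>
    rw [Finset.prod_insert ha, Finset.sum_insert ha, Derivation.leibniz, ih,
      derivative_one_sub_X_pow_inv (hd a)]
    simp only [smul_eq_mul]
    ring

theorem derivative_exp_subst {L : PowerSeries ℚ} (hL : constantCoeff L = 0) :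
    PowerSeries.derivative ℚ ((PowerSeries.exp ℚ).subst L) =
      PowerSeries.derivative ℚ L * (PowerSeries.exp ℚ).subst L := by
  rw [derivative_subst (HasSubst.of_constantCoeff_zero' hL), mul_comm]
  congr 2
  ext n
  rw [coeff_derivative, coeff_exp, coeff_exp]
  simp only [map_div₀, map_one, map_natCast, Nat.factorial_succ]
  push_cast
  field_simp

theorem constantCoeff_exp_subst {L : PowerSeries ℚ} (hL : constantCoeff L = 0) :
    constantCoeff ((PowerSeries.exp ℚ).subst L) = 1 := by
  have hs : HasSubst L := HasSubst.of_constantCoeff_zero' hL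
  have h1 : (PowerSeries.exp ℚ - 1).subst L = (PowerSeries.exp ℚ).subst L - 1 := by
    rw [← coe_substAlgHom hs, map_sub, map_one]
  have h2 := constantCoeff_subst_eq_zero (a := L) hL (PowerSeries.exp ℚ - 1) (by simp)
  rw [h1] at h2
  have h3 := (map_sub (constantCoeff (R := ℚ)) ((PowerSeries.exp ℚ).subst L) 1).symm.trans h2
  rwa [map_one, sub_eq_zero] at h3

theorem hasFormalProd_of_coeff {ι : Type*} {F : ι → PowerSeries ℚ} {a : PowerSeries ℚ}
    (h : ∀ n, ∃ s : Finset ι, ∀ t, s ⊆ t → coeff n (∏ i ∈ t, F i) = coeff n a) :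
    HasFormalProd F a := by
  unfold HasFormalProd
  let : TopologicalSpace ℚ := ⊥
  dsimp only [HasProd]
  rw [SummationFilter.unconditional_filter]
  refine (PowerSeries.WithPiTopology.tendsto_iff_coeff_tendsto _ _ _ _).mpr fun n => ?_
  obtain ⟨s, hs⟩ := h n
  refine tendsto_const_nhds.congr' ?_
  filter_upwards [Filter.eventually_ge_atTop s] with t ht
  exact (hs t ht).symm

/-- Euler product: the exponential of `∑ N_n tⁿ / n` is the product of the `(1 - t ^ d i)⁻¹`
when `N_n` is the sum of the `d i` dividing `n`. -/
theorem hasFormalProd_exp_subst {ι : Type*} (d : ι → ℕ) (hd : ∀ i, 1 ≤ d i)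
    (hfin : ∀ m, {i | d i ≤ m}.Finite) (N : ℕ → ℚ)
    (hN : ∀ n, 1 ≤ n → N n = ∑ i ∈ (hfin n).toFinset, if d i ∣ n then (d i : ℚ) else 0) :
    HasFormalProd (fun i => (1 - X ^ d i : PowerSeries ℚ)⁻¹)
      ((PowerSeries.exp ℚ).subst (PowerSeries.mk fun n : ℕ => N n / (n : ℚ))) := by
  -- Factors with `d i > n` are `1` modulo `t ^ (n + 1)`, so those with `d i ≤ n` determine the
  -- coefficient of `tⁿ`.
  refine hasFormalProd_of_coeff fun n => ⟨(hfin n).toFinset, fun t ht => ?_⟩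
  have hL : constantCoeff (PowerSeries.mk fun n : ℕ => N n / (n : ℚ)) = 0 := by simp
  refine coeff_eq_of_derivative_eq_mul ?_ (derivative_prod_one_sub_X_pow_inv d t hd)
    (derivative_exp_subst hL) (N := n) ?_ n le_rfl
  · rw [constantCoeff_exp_subst hL, map_prod]
    apply Finset.prod_eq_one
    intro i _
    have : d i ≠ 0 := by have := hd i; lia
    simp [this]
  -- Here `m + 1 ≤ n`, so no `d i > n` divides `m + 1` and the extra indices in `t` contribute zero.
  · intro m hm
    rw [coeff_derivative, coeff_mk, hN (m + 1) (by lia)]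
    push_cast
    rw [div_mul_cancel₀ _ (by positivity), map_sum]
    simp only [logDerivSeries, coeff_mk]
    symm
    classical
    refine Finset.sum_subset_zero_on_sdiff (M := ℚ) ?_ ?_ fun _ _ => rfl
    · refine subset_trans (fun i hi => ?_) ht
      simp only [Set.Finite.mem_toFinset, Set.mem_ofPred_eq] at hi ⊢
      lia
    · intro i hi
      simp only [Finset.mem_sdiff, Set.Finite.mem_toFinset, Set.mem_ofPred_eq] at hi
      refine if_neg fun hdvd => hi.2 (Nat.le_of_dvd (by lia) hdvd)

open scoped PowerSeries.WithPiTopology in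
theorem HasFormalProd.of_fibers {ι κ R : Type*} [CommRing R] {F : ι → PowerSeries R}
    {a : PowerSeries R} (h : HasFormalProd F a) (p : ι → κ) (hp : ∀ j, (p ⁻¹' {j}).Finite) :
    HasFormalProd (fun j => ∏ᶠ i ∈ p ⁻¹' {j}, F i) a := by
  let : TopologicalSpace R := ⊥
  have : DiscreteTopology R := ⟨rfl⟩
  unfold HasFormalProd at h ⊢
  have : IsTopologicalRing (PowerSeries R) := PowerSeries.WithPiTopology.instIsTopologicalRing R
  have h1 : HasProd (fun s : Σ j, p ⁻¹' {j} => F s.2) a := by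
    rw [← (Equiv.sigmaFiberEquiv p).hasProd_iff] at h
    exact h
  refine h1.sigma fun j => ?_
  have : Fintype (p ⁻¹' {j}) := (hp j).fintype
  have h2 := hasProd_fintype (fun c : p ⁻¹' {j} => F c)
  rwa [← finprod_eq_prod_of_fintype, finprod_set_coe_eq_finprod_mem] at h2

end Series

/-! ### Points over finite extensions and closed points -/

section Points

variable {k : Type u} [Field k] {X : Scheme.{u}} (s : X ⟶ Spec (.of k))

theorem finrank_finiteExtension [Finite k] (n : ℕ) (hn : 1 ≤ n) :
    Module.finrank k (FiniteExtension k n) = n := by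
  obtain ⟨p, hp⟩ := CharP.exists k
  have hpp : Fact p.Prime := ⟨CharP.char_is_prime k p⟩
  have : NeZero n := ⟨by lia⟩
  let e : FiniteField.Extension k p n ≃ₐ[k] FiniteExtension k n :=
    Polynomial.IsSplittingField.algEquiv _ (Polynomial.X ^ (Nat.card k ^ n) - Polynomial.X)
  rw [← e.toLinearEquiv.finrank_eq, FiniteField.finrank_extension]

/-- The canonical map from a ring to a residue field of its spectrum. -/
noncomputable def specToResidueField (R : CommRingCat.{u}) (y : Spec R) :
    R ⟶ (Spec R).residueField y :=
  have : y.asIdeal.IsPrime := y.isPrime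
  CommRingCat.ofHom (algebraMap R y.asIdeal.ResidueField) ≫ (Scheme.Spec.residueFieldIso R y).inv

theorem specToResidueField_bijective {R : CommRingCat.{u}} (hR : IsField R) (y : Spec R) :
    Function.Bijective (specToResidueField R y).hom := by
  let := hR.toField
  have : y.asIdeal.IsPrime := y.isPrime
  have : y.asIdeal.IsMaximal := by
    have h : y.asIdeal = ⊥ := (eq_bot_or_eq_top _).resolve_right y.isPrime.ne_top
    rw [h]
    exact Ideal.bot_isMaximal
  exact (Scheme.Spec.residueFieldIso R y).symm.commRingCatIsoToRingEquiv.bijective.comp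
    ⟨(algebraMap R y.asIdeal.ResidueField).injective, Ideal.algebraMap_residueField_surjective _⟩

/-- The structure map `k → κ(x)` of the residue field of a `k`-scheme. -/
noncomputable def toResidueField (x : X) : CommRingCat.of k ⟶ X.residueField x :=
  specToResidueField (.of k) (s x) ≫ s.residueFieldMap x

theorem SpecMap_toResidueField (x : X) :
    Spec.map (toResidueField s x) = X.fromSpecResidueField x ≫ s := by
  rw [toResidueField, Spec.map_comp, specToResidueField, Spec.map_comp,
    ← Scheme.Hom.SpecMap_residueFieldMap_fromSpecResidueField,
    Scheme.Spec.map_residueFieldIso_inv_eq_fromSpecResidueField]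

/-- `pointDegree` is a degree over the residue field of the point of `Spec k`; that field is `k`
itself by `specToResidueField_bijective`. -/
theorem finrank_toResidueField (x : X) :
    letI := (toResidueField s x).hom.toAlgebra
    Module.finrank k (X.residueField x) = pointDegree s x := by
  let := (toResidueField s x).hom.toAlgebra
  let := (s.residueFieldMap x).hom.toAlgebra
  exact Algebra.finrank_eq_of_equiv_equiv (RingEquiv.ofBijective _
    (specToResidueField_bijective (Field.toIsField k) (s x))) (RingEquiv.refl _) rfl

/-- This is the Nullstellensatz: for closed `x` the map `Spec κ(x) ⟶ X` is a closed immersion, so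
`κ(x)` is of finite type over `k`, hence finite. -/
theorem finite_residueField [LocallyOfFiniteType s] {x : X} (hx : x ∈ closedPoints X) :
    (toResidueField s x).hom.Finite := by
  have := isClosed_singleton_iff_isClosedImmersion.mp hx
  have h := (isFinite_iff_locallyOfFiniteType_of_jacobsonSpace
    (f := X.fromSpecResidueField x ≫ s)).mpr inferInstance
  rwa [← SpecMap_toResidueField, IsFinite.SpecMap_iff] at h

/-- Since `X` is a Jacobson space, `x` is closed as soon as `Spec κ(x) ⟶ X` is locally of finite
type, and this is inherited from the composite to `Spec k`. -/
theorem mem_closedPoints_of_finite [LocallyOfFiniteType s] {x : X}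
    (hx : (toResidueField s x).hom.Finite) : x ∈ closedPoints X := by
  have : JacobsonSpace X := LocallyOfFiniteType.jacobsonSpace s
  have h : IsFinite (X.fromSpecResidueField x ≫ s) := by
    rwa [← SpecMap_toResidueField, IsFinite.SpecMap_iff]
  exact isClosed_singleton_iff_locallyOfFiniteType.mpr
    (locallyOfFiniteType_of_comp (X.fromSpecResidueField x) s)

theorem one_le_pointDegree [LocallyOfFiniteType s] {x : X} (hx : x ∈ closedPoints X) :
    1 ≤ pointDegree s x := by
  rw [← finrank_toResidueField]
  let := (toResidueField s x).hom.toAlgebra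
  have : Module.Finite k (X.residueField x) := finite_residueField s hx
  exact Module.finrank_pos

theorem comp_eq_iff_toResidueField_comp {L : Type u} [Field L] (φ : CommRingCat.of k ⟶ .of L)
    (p : Spec (.of L) ⟶ X) :
    p ≫ s = Spec.map φ ↔
      toResidueField s (Scheme.SpecToEquivOfField L X p).1 ≫
        (Scheme.SpecToEquivOfField L X p).2 = φ := by
  obtain ⟨⟨x, ψ⟩, rfl⟩ := (Scheme.SpecToEquivOfField L X).symm.surjective p
  rw [Equiv.apply_symm_apply, ← Spec.map_inj, Spec.map_comp, SpecMap_toResidueField]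
  simp only [Scheme.SpecToEquivOfField_symm_apply, Category.assoc]

/-- A subtype of a sigma type as a sigma type of subtypes. -/
def subtypeSigmaEquivSigmaSubtype {α : Type*} {β : α → Type*} (P : ∀ a, β a → Prop) :
    {y : Sigma β // P y.1 y.2} ≃ Σ a, {b // P a b} where
  toFun y := ⟨y.1.1, y.1.2, y.2⟩
  invFun y := ⟨⟨y.1, y.2.1⟩, y.2.2⟩
  left_inv _ := rfl
  right_inv _ := rfl

/-- Points of a `k`-scheme with values in an extension of `k` in terms of residue fields. -/
noncomputable def pointsEquiv (L : Type u) [Field L] [Algebra k L] :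
    {p : Spec (.of L) ⟶ X // p ≫ s = Spec.map (CommRingCat.ofHom (algebraMap k L))} ≃
      Σ x : X, {φ : X.residueField x ⟶ .of L //
        toResidueField s x ≫ φ = CommRingCat.ofHom (algebraMap k L)} :=
  Equiv.trans (Equiv.subtypeEquiv (Scheme.SpecToEquivOfField L X)
      fun p => comp_eq_iff_toResidueField_comp s (CommRingCat.ofHom (algebraMap k L)) p)
    (subtypeSigmaEquivSigmaSubtype fun (x : X) (φ : X.residueField x ⟶ CommRingCat.of L) =>
      toResidueField s x ≫ φ = CommRingCat.ofHom (algebraMap k L))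

/-- A morphism from `k` to `L` under `k` as an algebra homomorphism. -/
def underEquivAlgHom {A B : Type u} [CommRing A] [CommRing B] [Algebra k A] [Algebra k B] :
    {φ : CommRingCat.of A ⟶ .of B //
      CommRingCat.ofHom (algebraMap k A) ≫ φ = CommRingCat.ofHom (algebraMap k B)} ≃
      (A →ₐ[k] B) where
  toFun φ := ⟨φ.1.hom, fun r => congr($(φ.2).hom r)⟩
  invFun φ := ⟨CommRingCat.ofHom φ.toRingHom, by ext r; exact φ.commutes r⟩
  left_inv _ := rfl
  right_inv _ := rfl

theorem finite_algHom {A L : Type u} [CommRing A] [Algebra k A] [Algebra.FiniteType k A]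
    [Field L] [Algebra k L] [Finite L] : Finite (A →ₐ[k] L) := by
  obtain ⟨n, f, hf⟩ := Algebra.FiniteType.iff_quotient_mvPolynomial''.mp
    (inferInstance : Algebra.FiniteType k A)
  refine Finite.of_injective
    (fun (φ : A →ₐ[k] L) (i : Fin n) => φ (f (MvPolynomial.X i))) fun φ ψ h => ?_
  have h1 : φ.comp f = ψ.comp f := MvPolynomial.algHom_ext fun i => congrFun h i
  ext a
  obtain ⟨b, rfl⟩ := hf a
  exact congr($h1 b)

theorem finite_points_of_isAffine [LocallyOfFiniteType s] [IsAffine X] (L : Type u) [Field L]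
    [Algebra k L] [Finite L] :
    Finite {p : Spec (.of L) ⟶ X // p ≫ s = Spec.map (CommRingCat.ofHom (algebraMap k L))} := by
  obtain ⟨φ, hφ⟩ := Spec.map_surjective (X.isoSpec.inv ≫ s)
  have hft : φ.hom.FiniteType := by
    rw [← HasRingHomProperty.Spec_iff (P := @LocallyOfFiniteType), hφ]
    infer_instance
  let := φ.hom.toAlgebra
  have : Algebra.FiniteType k Γ(X, ⊤) := hft
  have := finite_algHom (k := k) (A := Γ(X, ⊤)) (L := L)
  refine Finite.of_injective (β := Γ(X, ⊤) →ₐ[k] L)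
    (fun p => underEquivAlgHom ⟨Spec.preimage (p.1 ≫ X.isoSpec.hom), ?_⟩) ?_
  · rw [← Spec.map_inj, Spec.map_comp, Spec.map_preimage, Category.assoc]
    refine Eq.trans ?_ p.2
    congr 1
    exact (Iso.eq_inv_comp _).mp hφ
  · intro p q h
    have h1 := Subtype.ext_iff.mp (underEquivAlgHom.injective h)
    have h2 := congrArg Spec.map h1
    simp only [Spec.map_preimage] at h2
    exact Subtype.ext ((cancel_mono X.isoSpec.hom).mp h2)

/-- `Spec L` has a single point, so an `L`-point of `X` factors through one member of a finite
affine cover. On an affine scheme, `L`-points are determined by the images of finitely many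
generators. -/
theorem finite_points [LocallyOfFiniteType s] [CompactSpace X] (L : Type u) [Field L]
    [Algebra k L] [Finite L] :
    Finite {p : Spec (.of L) ⟶ X // p ≫ s = Spec.map (CommRingCat.ofHom (algebraMap k L))} := by
  let 𝒰 := X.affineCover.finiteSubcover
  have : ∀ i, Finite {p : Spec (.of L) ⟶ 𝒰.X i // p ≫ 𝒰.f i ≫ s =
      Spec.map (CommRingCat.ofHom (algebraMap k L))} := fun i =>
    finite_points_of_isAffine (𝒰.f i ≫ s) L
  refine Finite.of_surjective (α := Σ i, {p : Spec (.of L) ⟶ 𝒰.X i // p ≫ 𝒰.f i ≫ s =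
      Spec.map (CommRingCat.ofHom (algebraMap k L))})
    (fun y => ⟨y.2.1 ≫ 𝒰.f y.1, by rw [Category.assoc]; exact y.2.2⟩) fun p => ?_
  let x := p.1 (IsLocalRing.closedPoint L)
  obtain ⟨z, hz⟩ := 𝒰.covers x
  have hr : Set.range p.1 ⊆ Set.range (𝒰.f (𝒰.idx x)) := by
    rintro _ ⟨y, rfl⟩
    rw [Subsingleton.elim y (IsLocalRing.closedPoint L)]
    exact ⟨z, hz⟩
  refine ⟨⟨𝒰.idx x, IsOpenImmersion.lift (𝒰.f (𝒰.idx x)) p.1 hr, ?_⟩, Subtype.ext ?_⟩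
  · rw [IsOpenImmersion.lift_fac_assoc, p.2]
  · exact IsOpenImmersion.lift_fac _ _ _

/-- A closed point of degree `n` is the image of some point over the extension of degree `n`, and
there are finitely many of those. -/
theorem finite_closedPoints_pointDegree_le [Finite k] [LocallyOfFiniteType s] [CompactSpace X]
    (m : ℕ) : {x : closedPoints X | pointDegree s x.1 ≤ m}.Finite := by
  have h1 : ∀ n, 1 ≤ n → {x : closedPoints X | pointDegree s x.1 = n}.Finite := fun n hn => by
    have hfin : Finite (FiniteExtension k n) := Module.finite_of_finite k
    have := finite_points s (FiniteExtension k n)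
    refine Set.Finite.of_finite_image (f := Subtype.val)
      ((Set.finite_range fun p : {p : Spec (.of (FiniteExtension k n)) ⟶ X // p ≫ s =
        Spec.map (CommRingCat.ofHom (algebraMap k (FiniteExtension k n)))} =>
          (pointsEquiv s _ p).1).subset ?_) Subtype.val_injective.injOn
    rintro _ ⟨x, hx, rfl⟩
    let := (toResidueField s x.1).hom.toAlgebra
    have h2 : Module.finrank k (X.residueField x.1) = n := (finrank_toResidueField s x.1).trans hx
    obtain ⟨φ⟩ := FiniteField.nonempty_algHom_of_finrank_dvd (F := k) (K := X.residueField x.1)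
      (L := FiniteExtension k n) (by rw [h2, finrank_finiteExtension n hn])
    refine ⟨(pointsEquiv s _).symm ⟨x.1, underEquivAlgHom.symm φ⟩, ?_⟩
    simp only [Equiv.apply_symm_apply]
  refine ((Set.finite_Icc 1 m).biUnion fun n hn => h1 n hn.1).subset fun x hx => ?_
  simp only [Set.mem_iUnion]
  exact ⟨pointDegree s x.1, ⟨one_le_pointDegree s x.2, hx⟩, rfl⟩

/-- Galois theory of finite fields. The formula also covers `κ(x)` infinite over `k`: its `finrank`
is then `0`, which does not divide `n ≥ 1`, and no embedding exists. -/
theorem card_under_finiteExtension [Finite k] (x : X) (n : ℕ) (hn : 1 ≤ n) :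
    Nat.card {φ : X.residueField x ⟶ .of (FiniteExtension k n) //
      toResidueField s x ≫ φ = CommRingCat.ofHom (algebraMap k (FiniteExtension k n))} =
      if pointDegree s x ∣ n then pointDegree s x else 0 := by
  have hfin : Finite (FiniteExtension k n) := Module.finite_of_finite k
  let := (toResidueField s x).hom.toAlgebra
  rw [← finrank_toResidueField]
  refine (Nat.card_congr (underEquivAlgHom (k := k) (A := X.residueField x)
    (B := FiniteExtension k n))).trans ?_
  split_ifs with h
  · refine FiniteField.natCard_algHom_of_finrank_dvd ?_
    rwa [finrank_finiteExtension n hn]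
  · rw [← finrank_finiteExtension (k := k) n hn] at h
    have := not_nonempty_iff.mp (mt FiniteField.nonempty_algHom_iff_finrank_dvd.mp h)
    exact Nat.card_of_isEmpty

theorem pointCount_eq_sum [Finite k] [LocallyOfFiniteType s] [CompactSpace X]
    (n : ℕ) (hn : 1 ≤ n) :
    pointCount s n = ∑ x ∈ (finite_closedPoints_pointDegree_le s n).toFinset,
      if pointDegree s x.1 ∣ n then pointDegree s x.1 else 0 := by
  have hfin : Finite (FiniteExtension k n) := Module.finite_of_finite k
  have hpts := finite_points s (FiniteExtension k n)
  let H : X → Type u := fun x => {φ : X.residueField x ⟶ .of (FiniteExtension k n) //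
      toResidueField s x ≫ φ = CommRingCat.ofHom (algebraMap k (FiniteExtension k n))}
  have hpts' : Finite (Σ x, H x) := Finite.of_equiv _ (pointsEquiv s (FiniteExtension k n))
  have hH : ∀ x, Finite (H x) := fun x => Finite.of_injective (Sigma.mk x) sigma_mk_injective
  -- A residue field that embeds in a finite field is finite, so only closed points contribute; by
  -- `hH2` their degrees divide, hence are at most, `n`.
  have hH1 : ∀ x, H x → x ∈ closedPoints X := by
    intro x φ
    refine mem_closedPoints_of_finite s ?_
    have : Finite (X.residueField x) := Finite.of_injective _ φ.1.hom.injective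
    let := (toResidueField s x).hom.toAlgebra
    exact (inferInstance : Module.Finite k (X.residueField x))
  have hH2 : ∀ x, H x → pointDegree s x ≤ n := by
    intro x φ
    have h := card_under_finiteExtension s x n hn
    by_contra hlt
    rw [if_neg fun hd => hlt (Nat.le_of_dvd hn hd)] at h
    have : Nonempty (H x) := ⟨φ⟩
    exact (Nat.card_pos (α := H x)).ne' h
  unfold pointCount
  rw [Nat.card_congr (pointsEquiv s (FiniteExtension k n))]
  have hF := (finite_closedPoints_pointDegree_le s n).fintype
  rw [Nat.card_congr (Equiv.sigmaSubtypeEquivOfSubset H (· ∈ closedPoints X) hH1).symm,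
    Nat.card_congr (Equiv.sigmaSubtypeEquivOfSubset (fun x : closedPoints X => H x.1)
      (fun x => pointDegree s x.1 ≤ n) fun x => hH2 x.1).symm]
  have : Fintype {x : closedPoints X // pointDegree s x.1 ≤ n} := hF
  rw [Nat.card_sigma, Finset.sum_subtype (p := fun x : closedPoints X => pointDegree s x.1 ≤ n)
    _ (by simp)]
  exact Finset.sum_congr rfl fun x _ => card_under_finiteExtension s x.1.1 n hn

/-- The Euler product of the zeta function of a scheme of finite type over a finite field. -/
theorem hasFormalProd_zetaFunction [Finite k] [LocallyOfFiniteType s] [CompactSpace X] :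
    HasFormalProd (fun x : closedPoints X =>
      (1 - PowerSeries.X ^ pointDegree s x.1 : PowerSeries ℚ)⁻¹) (zetaFunction s) := by
  refine hasFormalProd_exp_subst _ (fun x => one_le_pointDegree s x.2)
    (finite_closedPoints_pointDegree_le s) _ fun n hn => ?_
  rw [pointCount_eq_sum s n hn]
  push_cast
  rfl

end Points

/-! ### Ramification index and inertia degree under localization -/

section ResidueFields

open IsLocalRing

theorem ramificationIdx_maximalIdeal_eq_one {R A : Type*} [CommRing R] [CommRing A] [Algebra R A]
    (p : Ideal R) [p.IsPrime] [IsLocalization.AtPrime A p] [IsLocalRing A] :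
    (maximalIdeal A).ramificationIdx R = 1 := by
  have := Algebra.FormallyUnramified.of_isLocalization (Rₘ := A) p.primeCompl
  have := Algebra.EssFiniteType.of_isLocalization A p.primeCompl
  have : Algebra.IsUnramifiedAt R (maximalIdeal A) := by
    unfold Algebra.IsUnramifiedAt
    have := Algebra.FormallyUnramified.of_isLocalization
      (Rₘ := Localization.AtPrime (maximalIdeal A)) (maximalIdeal A).primeCompl
    exact Algebra.FormallyUnramified.comp R A _
  exact Ideal.ramificationIdx_eq_one _ _

variable {R S : Type*} (A B : Type*) [CommRing R] [CommRing S] [CommRing A] [CommRing B]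
  [Algebra R S] [Algebra R A] [Algebra S B] [Algebra A B] [Algebra R B]
  [IsScalarTower R S B] [IsScalarTower R A B] (p : Ideal R) (q : Ideal S)
  [IsLocalRing A] [IsLocalRing B]

include p in
-- Multiplicativity in the towers `R → S → B` and `R → A → B`: the localizations `S → B` and `R → A`
-- are unramified and contribute `1`. Flatness of `R → S` passes to `A → B`.
theorem ramificationIdx_maximalIdeal [p.IsPrime] [q.IsPrime] [IsLocalization.AtPrime A p]
    [IsLocalization.AtPrime B q] [Module.Flat R S] [IsLocalHom (algebraMap A B)] :
    (maximalIdeal B).ramificationIdx A = q.ramificationIdx R := by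
  have := IsLocalization.flat B q.primeCompl
  have : Module.Flat R B := Module.Flat.trans R S B
  have : Module.Flat A B := (Module.flat_iff_of_isLocalization A p.primeCompl B).mpr this
  have : (maximalIdeal B).LiesOver q := IsLocalization.AtPrime.liesOver_maximalIdeal B q
  have h1 := Ideal.ramificationIdx_tower (R := R) q (maximalIdeal B)
  have h2 := Ideal.ramificationIdx_tower (R := R) (maximalIdeal A) (maximalIdeal B)
  rw [ramificationIdx_maximalIdeal_eq_one (A := B) q, mul_one] at h1
  rw [ramificationIdx_maximalIdeal_eq_one (A := A) p, one_mul] at h2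
  exact h2.symm.trans h1

theorem finrank_residueField_eq_inertiaDeg [q.LiesOver p] [p.IsMaximal] [q.IsMaximal]
    [IsLocalization.AtPrime A p] [IsLocalization.AtPrime B q] [IsLocalHom (algebraMap A B)] :
    Module.finrank (ResidueField A) (ResidueField B) = q.inertiaDeg R := by
  rw [Ideal.inertiaDeg_eq_of_isMaximal p q]
  symm
  refine Algebra.finrank_eq_of_equiv_equiv (IsLocalization.AtPrime.equivQuotMaximalIdeal p A)
    (IsLocalization.AtPrime.equivQuotMaximalIdeal q B) ?_
  refine Ideal.Quotient.ringHom_ext ?_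
  ext r
  change algebraMap (ResidueField A) (ResidueField B) (residue A (algebraMap R A r)) =
    residue B (algebraMap S B (algebraMap R S r))
  rw [ResidueField.algebraMap_residue, ← IsScalarTower.algebraMap_apply,
    ← IsScalarTower.algebraMap_apply]

end ResidueFields

/-! ### Fibres of affine morphisms and the identity `∑ e f = n` -/

section Fiber
open IsLocalRing
variable {X Y : Scheme.{u}} (π : X ⟶ Y) {U : Y.Opens} (hU : IsAffineOpen U)
  {y : X} (hy : π y ∈ U)

/-- The prime ideal of the affine open `π ⁻¹ U` that corresponds to a point. -/
noncomputable def fiberPrime [IsAffineHom π] : Ideal Γ(X, π ⁻¹ᵁ U) :=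
  ((hU.preimage π).primeIdealOf ⟨y, hy⟩).asIdeal

instance [IsAffineHom π] : (fiberPrime π hU hy).IsPrime :=
  ((hU.preimage π).primeIdealOf ⟨y, hy⟩).isPrime

theorem fiberPrime_comap [IsAffineHom π] :
    (fiberPrime π hU hy).comap (π.app U).hom = (hU.primeIdealOf ⟨π y, hy⟩).asIdeal := by
  rw [← hU.comap_primeIdealOf_appLE U (π ⁻¹ᵁ U) (hU.preimage π) le_rfl hy, Scheme.Hom.app_eq_appLE]
  rfl

/-- The stalks at `π y` and `y` are the localizations of the section rings over `U` and `π ⁻¹ U` at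
the corresponding primes, so an invariant of stalks becomes one of a ring extension. -/
theorem ramificationIndex_eq [IsAffineHom π] (hflat : (π.app U).hom.Flat) :
    letI := (π.app U).hom.toAlgebra
    ramificationIndex π y = (fiberPrime π hU hy).ramificationIdx Γ(Y, U) := by
  let := (π.app U).hom.toAlgebra
  let := (π.stalkMap y).hom.toAlgebra
  let := (Y.presheaf.germ U (π y) hy).hom.toAlgebra
  let := (X.presheaf.germ (π ⁻¹ᵁ U) y hy).hom.toAlgebra
  let := (π.app U ≫ X.presheaf.germ (π ⁻¹ᵁ U) y hy).hom.toAlgebra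
  have : IsScalarTower Γ(Y, U) Γ(X, π ⁻¹ᵁ U) (X.presheaf.stalk y) := .of_algebraMap_eq' rfl
  have : IsScalarTower Γ(Y, U) (Y.presheaf.stalk (π y)) (X.presheaf.stalk y) :=
    .of_algebraMap_eq' (congrArg CommRingCat.Hom.hom (Scheme.Hom.germ_stalkMap π U y hy).symm)
  have : (hU.primeIdealOf ⟨π y, hy⟩).asIdeal.IsPrime := (hU.primeIdealOf ⟨π y, hy⟩).isPrime
  have h1 : IsLocalization.AtPrime (Y.presheaf.stalk (π y)) (hU.primeIdealOf ⟨π y, hy⟩).asIdeal :=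
    hU.isLocalization_stalk ⟨π y, hy⟩
  have h2 : IsLocalization.AtPrime (X.presheaf.stalk y) (fiberPrime π hU hy) :=
    (hU.preimage π).isLocalization_stalk ⟨y, hy⟩
  have : Module.Flat Γ(Y, U) Γ(X, π ⁻¹ᵁ U) := hflat
  have : (fiberPrime π hU hy).LiesOver (hU.primeIdealOf ⟨π y, hy⟩).asIdeal :=
    ⟨(fiberPrime_comap π hU hy).symm⟩
  have : IsLocalHom (algebraMap (Y.presheaf.stalk (π y)) (X.presheaf.stalk y)) :=
    inferInstanceAs (IsLocalHom (π.stalkMap y).hom)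
  exact ramificationIdx_maximalIdeal (Y.presheaf.stalk (π y)) (X.presheaf.stalk y)
    (hU.primeIdealOf ⟨π y, hy⟩).asIdeal (fiberPrime π hU hy)

theorem inertiaDegree_eq [IsAffineHom π] (hint : (π.app U).hom.IsIntegral)
    (hcl : IsClosed {π y}) :
    letI := (π.app U).hom.toAlgebra
    inertiaDegree π y = (fiberPrime π hU hy).inertiaDeg Γ(Y, U) := by
  let := (π.app U).hom.toAlgebra
  let := (π.stalkMap y).hom.toAlgebra
  let := (Y.presheaf.germ U (π y) hy).hom.toAlgebra
  let := (X.presheaf.germ (π ⁻¹ᵁ U) y hy).hom.toAlgebra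
  let := (π.app U ≫ X.presheaf.germ (π ⁻¹ᵁ U) y hy).hom.toAlgebra
  have : IsScalarTower Γ(Y, U) Γ(X, π ⁻¹ᵁ U) (X.presheaf.stalk y) := .of_algebraMap_eq' rfl
  have : IsScalarTower Γ(Y, U) (Y.presheaf.stalk (π y)) (X.presheaf.stalk y) :=
    .of_algebraMap_eq' (congrArg CommRingCat.Hom.hom (Scheme.Hom.germ_stalkMap π U y hy).symm)
  have : (hU.primeIdealOf ⟨π y, hy⟩).asIdeal.IsPrime := (hU.primeIdealOf ⟨π y, hy⟩).isPrime
  have h1 : IsLocalization.AtPrime (Y.presheaf.stalk (π y)) (hU.primeIdealOf ⟨π y, hy⟩).asIdeal :=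
    hU.isLocalization_stalk ⟨π y, hy⟩
  have h2 : IsLocalization.AtPrime (X.presheaf.stalk y) (fiberPrime π hU hy) :=
    (hU.preimage π).isLocalization_stalk ⟨y, hy⟩
  have : (fiberPrime π hU hy).LiesOver (hU.primeIdealOf ⟨π y, hy⟩).asIdeal :=
    ⟨(fiberPrime_comap π hU hy).symm⟩
  have : IsLocalHom (algebraMap (Y.presheaf.stalk (π y)) (X.presheaf.stalk y)) :=
    inferInstanceAs (IsLocalHom (π.stalkMap y).hom)
  have : Algebra.IsIntegral Γ(Y, U) Γ(X, π ⁻¹ᵁ U) := ⟨hint⟩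
  have : (hU.primeIdealOf ⟨π y, hy⟩).asIdeal.IsMaximal :=
    hU.primeIdealOf_isMaximal_of_isClosed ⟨π y, hy⟩ hcl
  have : (fiberPrime π hU hy).IsMaximal :=
    Ideal.IsMaximal.of_liesOver_isMaximal _ (hU.primeIdealOf ⟨π y, hy⟩).asIdeal
  let := (π.residueFieldMap y).hom.toAlgebra
  refine Eq.trans ?_ <| finrank_residueField_eq_inertiaDeg (Y.presheaf.stalk (π y)) (X.presheaf.stalk y)
    (hU.primeIdealOf ⟨π y, hy⟩).asIdeal (fiberPrime π hU hy)
  exact Algebra.finrank_eq_of_equiv_equiv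
    (RingEquiv.refl (ResidueField (Y.presheaf.stalk (π y))))
    (RingEquiv.refl (ResidueField (X.presheaf.stalk y))) rfl

theorem fromSpec_fiberPrime [IsAffineHom π] :
    (hU.preimage π).fromSpec ⟨fiberPrime π hU hy, inferInstance⟩ = y :=
  (hU.preimage π).fromSpec_primeIdealOf ⟨y, hy⟩

theorem mem_preimage_fromSpec [IsAffineHom π] (q : PrimeSpectrum Γ(X, π ⁻¹ᵁ U)) :
    π ((hU.preimage π).fromSpec q) ∈ U := by
  have h : (hU.preimage π).fromSpec q ∈ Set.range (hU.preimage π).fromSpec := ⟨q, rfl⟩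
  rwa [(hU.preimage π).range_fromSpec] at h

theorem fiberPrime_fromSpec [IsAffineHom π] (q : PrimeSpectrum Γ(X, π ⁻¹ᵁ U)) :
    fiberPrime π hU (mem_preimage_fromSpec π hU q) = q.asIdeal := by
  have h := fromSpec_fiberPrime π hU (mem_preimage_fromSpec π hU q)
  exact congrArg PrimeSpectrum.asIdeal ((hU.preimage π).fromSpec.isOpenEmbedding.injective h)

theorem map_eq_of_fiberPrime_comap [IsAffineHom π] {x : Y} (hx : x ∈ U)
    (h : (fiberPrime π hU hy).comap (π.app U).hom = (hU.primeIdealOf ⟨x, hx⟩).asIdeal) :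
    π y = x := by
  rw [fiberPrime_comap, ← PrimeSpectrum.ext_iff] at h
  exact (hU.fromSpec_primeIdealOf ⟨π y, hy⟩).symm.trans
    ((congrArg hU.fromSpec h).trans (hU.fromSpec_primeIdealOf ⟨x, hx⟩))

/-- Points in the fibre of an affine morphism as prime ideals. -/
noncomputable def fiberEquivPrimesOver [IsAffineHom π] {x : Y} (hx : x ∈ U) :
    letI := (π.app U).hom.toAlgebra
    {y // π y = x} ≃ (hU.primeIdealOf ⟨x, hx⟩).asIdeal.primesOver Γ(X, π ⁻¹ᵁ U) :=
  letI := (π.app U).hom.toAlgebra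
  { toFun := fun y => ⟨fiberPrime π hU (y := y.1) (y.2.symm ▸ hx), inferInstance, ⟨by
      obtain ⟨y, rfl⟩ := y
      exact (fiberPrime_comap π hU hx).symm⟩⟩
    invFun := fun q => ⟨(hU.preimage π).fromSpec ⟨q.1, q.2.1⟩, by
      refine map_eq_of_fiberPrime_comap π hU (mem_preimage_fromSpec π hU ⟨q.1, q.2.1⟩) hx ?_
      rw [fiberPrime_fromSpec]
      exact q.2.2.over.symm⟩
    left_inv := fun y => Subtype.ext (fromSpec_fiberPrime π hU (y.2.symm ▸ hx))
    right_inv := fun q => Subtype.ext (fiberPrime_fromSpec π hU ⟨q.1, q.2.1⟩) }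

include hU in
-- In an integral extension a prime over a maximal ideal is maximal. Points outside `π ⁻¹ U` cause
-- no trouble: a specialization of `y` maps to a specialization of the closed point `π y`, so it
-- lies in the same fibre.
theorem mem_closedPoints_of_isIntegral [IsAffineHom π] (hint : (π.app U).hom.IsIntegral)
    {x : Y} (hx : x ∈ U) (hcl : IsClosed {x}) {y : X} (hyx : π y = x) : y ∈ closedPoints X := by
  subst hyx
  let := (π.app U).hom.toAlgebra
  have : Algebra.IsIntegral Γ(Y, U) Γ(X, π ⁻¹ᵁ U) := ⟨hint⟩
  have : (hU.primeIdealOf ⟨π y, hx⟩).asIdeal.IsMaximal :=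
    hU.primeIdealOf_isMaximal_of_isClosed ⟨π y, hx⟩ hcl
  have : (fiberPrime π hU hx).LiesOver (hU.primeIdealOf ⟨π y, hx⟩).asIdeal :=
    ⟨(fiberPrime_comap π hU hx).symm⟩
  have hmax : (fiberPrime π hU hx).IsMaximal :=
    Ideal.IsMaximal.of_liesOver_isMaximal _ (hU.primeIdealOf ⟨π y, hx⟩).asIdeal
  rw [mem_closedPoints_iff, ← closure_subset_iff_isClosed]
  intro z hz
  have hz' : y ⤳ z := specializes_iff_mem_closure.mpr hz
  have h1 : π z = π y := hcl.closure_subset_iff.mpr subset_rfl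
    (specializes_iff_mem_closure.mp (hz'.map π.continuous))
  have h2 : π z ∈ U := h1 ▸ hx
  rw [← fromSpec_fiberPrime π hU hx, ← fromSpec_fiberPrime π hU h2] at hz'
  have h3 := (PrimeSpectrum.le_iff_specializes _ _).mpr
    ((hU.preimage π).fromSpec.isOpenEmbedding.isInducing.specializes_iff.mp hz')
  have h4 : fiberPrime π hU hx = fiberPrime π hU h2 :=
    hmax.eq_of_le (inferInstance : (fiberPrime π hU h2).IsPrime).ne_top h3
  exact (fromSpec_fiberPrime π hU h2).symm.trans ((congrArg (hU.preimage π).fromSpec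
    (PrimeSpectrum.ext h4.symm)).trans (fromSpec_fiberPrime π hU hx))

include hU in
/-- The fundamental identity `∑ e f = n` for the fibre over a closed point of a morphism that is
finite flat of rank `n` over an affine neighbourhood. -/
theorem exists_fiber_sum_ramificationIndex_mul_inertiaDegree [IsAffineHom π]
    {x : Y} (hx : x ∈ U) (hcl : IsClosed {x}) [IsDomain Γ(Y, U)]
    (hfin : (π.app U).hom.Finite) (hflat : (π.app U).hom.Flat) {n : ℕ}
    (hrank : letI := (π.app U).hom.toAlgebra; Module.finrank Γ(Y, U) Γ(X, π ⁻¹ᵁ U) = n) :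
    ∃ F : Finset X, closedFiber π x = F ∧
      ∑ y ∈ F, ramificationIndex π y * inertiaDegree π y = n ∧
      ∀ y ∈ F, 1 ≤ ramificationIndex π y ∧ 1 ≤ inertiaDegree π y := by
  let := (π.app U).hom.toAlgebra
  have : Module.Finite Γ(Y, U) Γ(X, π ⁻¹ᵁ U) := hfin
  have : Module.Flat Γ(Y, U) Γ(X, π ⁻¹ᵁ U) := hflat
  have hint := hfin.to_isIntegral
  have hp : (hU.primeIdealOf ⟨x, hx⟩).asIdeal.IsPrime := (hU.primeIdealOf ⟨x, hx⟩).isPrime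
  let e := fiberEquivPrimesOver π hU hx
  have hFP : Finite ((hU.primeIdealOf ⟨x, hx⟩).asIdeal.primesOver Γ(X, π ⁻¹ᵁ U)) :=
    Algebra.QuasiFinite.finite_primesOver _
  have := Fintype.ofFinite ((hU.primeIdealOf ⟨x, hx⟩).asIdeal.primesOver Γ(X, π ⁻¹ᵁ U))
  have := Fintype.ofEquiv _ e.symm
  have he : ∀ y : {y // π y = x}, ramificationIndex π y.1 = (e y).1.ramificationIdx Γ(Y, U) :=
    fun y => ramificationIndex_eq π hU _ hflat
  have hf : ∀ y : {y // π y = x}, inertiaDegree π y.1 = (e y).1.inertiaDeg Γ(Y, U) :=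
    fun y => inertiaDegree_eq π hU _ hint (y.2.symm ▸ hcl)
  refine ⟨Finset.univ.map (Function.Embedding.subtype fun y => π y = x), ?_, ?_, ?_⟩
  · ext y
    simp only [closedFiber, Set.mem_ofPred_eq, Finset.coe_map, Finset.coe_univ, Set.image_univ,
      Function.Embedding.coe_subtype, Subtype.range_coe_subtype]
    exact and_iff_right_of_imp fun h => mem_closedPoints_of_isIntegral π hU hint hx hcl h
  -- The sum over the primes above `x` is the dimension of the fibre, which for a finite flat
  -- algebra over a domain equals its rank.
  · rw [Finset.sum_map, ← hrank,
      ← Ideal.sum_ramification_inertia_eq_finrank (hU.primeIdealOf ⟨x, hx⟩).asIdeal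
        Γ(X, π ⁻¹ᵁ U), ← e.sum_comp]
    exact Finset.sum_congr rfl fun y _ => congrArg₂ _ (he y) (hf y)
  · intro y hy
    obtain ⟨y, -, rfl⟩ := Finset.mem_map.mp hy
    have : (e y).1.IsPrime := (e y).2.1
    exact ⟨(he y).symm ▸ Ideal.ramificationIdx_pos _ _, (hf y).symm ▸ Ideal.inertiaDeg_pos _ _⟩

end Fiber

/-! ### Splitting types in a fibre of degree two -/

section QuadraticFiber

variable {X Y : Scheme.{u}} (π : X ⟶ Y)

theorem pointDegree_comp {k : Type u} [Field k] (t : Y ⟶ Spec (.of k)) (y : X) :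
    pointDegree (π ≫ t) y = inertiaDegree π y * pointDegree t (π y) := by
  let := (π.residueFieldMap y).hom.toAlgebra
  let := (t.residueFieldMap (π y)).hom.toAlgebra
  let := ((π ≫ t).residueFieldMap y).hom.toAlgebra
  let : Algebra ((Spec (CommRingCat.of k)).residueField (t (π y))) (X.residueField y) :=
    ((π ≫ t).residueFieldMap y).hom.toAlgebra
  have : IsScalarTower ((Spec (CommRingCat.of k)).residueField (t (π y)))
      (Y.residueField (π y)) (X.residueField y) := .of_algebraMap_eq' (by
    change ((π ≫ t).residueFieldMap y).hom = _
    rw [Scheme.residueFieldMap_comp]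
    rfl)
  rw [mul_comm]
  exact (Module.finrank_mul_finrank ((Spec (CommRingCat.of k)).residueField (t (π y)))
    (Y.residueField (π y)) (X.residueField y)).symm

/-- The possible shapes of a fibre with `∑ e f = 2`. -/
theorem fiber_cases {x : Y} {F : Finset X} (hF : closedFiber π x = F)
    (hsum : ∑ y ∈ F, ramificationIndex π y * inertiaDegree π y = 2)
    (hpos : ∀ y ∈ F, 1 ≤ ramificationIndex π y ∧ 1 ≤ inertiaDegree π y) :
    (∃ y, closedFiber π x = {y} ∧ ramificationIndex π y = 2 ∧ inertiaDegree π y = 1) ∨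
    (∃ y, closedFiber π x = {y} ∧ ramificationIndex π y = 1 ∧ inertiaDegree π y = 2) ∨
    (∃ y z, y ≠ z ∧ closedFiber π x = {y, z} ∧
      (ramificationIndex π y = 1 ∧ inertiaDegree π y = 1) ∧
      (ramificationIndex π z = 1 ∧ inertiaDegree π z = 1)) := by
  classical
  have hle : F.card ≤ 2 := by
    rw [← hsum, Finset.card_eq_sum_ones]
    exact Finset.sum_le_sum fun y hy => Nat.mul_pos (hpos y hy).1 (hpos y hy).2
  have hne : F.card ≠ 0 := fun h => by
    rw [Finset.card_eq_zero.mp h, Finset.sum_empty] at hsum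
    exact absurd hsum (by decide)
  obtain h | h : F.card = 1 ∨ F.card = 2 := by lia
  · obtain ⟨y, rfl⟩ := Finset.card_eq_one.mp h
    rw [Finset.sum_singleton] at hsum
    rw [Finset.coe_singleton] at hF
    rcases (Nat.dvd_prime Nat.prime_two).mp (Dvd.intro _ hsum) with h1 | h1
    · rw [h1, one_mul] at hsum
      exact Or.inr (Or.inl ⟨y, hF, h1, hsum⟩)
    · rw [h1] at hsum
      exact Or.inl ⟨y, hF, h1, by lia⟩
  · obtain ⟨y, z, hyz, rfl⟩ := Finset.card_eq_two.mp h
    rw [Finset.sum_pair hyz] at hsum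
    rw [Finset.coe_pair] at hF
    have hy := hpos y (by simp)
    have hz := hpos z (by simp)
    have h1 := Nat.mul_pos hy.1 hy.2
    have h2 := Nat.mul_pos hz.1 hz.2
    have h3 : ramificationIndex π y * inertiaDegree π y = 1 := by lia
    have h4 : ramificationIndex π z * inertiaDegree π z = 1 := by lia
    exact Or.inr (Or.inr ⟨y, z, hyz, hF, mul_eq_one.mp h3, mul_eq_one.mp h4⟩)

theorem map_eq_of_mem_closedFiber {x : Y} {y : X} (hy : y ∈ closedFiber π x) : π y = x := hy.2

/-- Trichotomy and local factors of a fibre with `∑ e f = 2`. -/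
theorem splitting_of_fiber {k : Type u} [Field k] (t : Y ⟶ Spec (.of k))
    {x : Y} {F : Finset X} (hF : closedFiber π x = F)
    (hsum : ∑ y ∈ F, ramificationIndex π y * inertiaDegree π y = 2)
    (hpos : ∀ y ∈ F, 1 ≤ ramificationIndex π y ∧ 1 ≤ inertiaDegree π y) :
    ((IsRamified π x ∧ ¬ IsSplit π x ∧ ¬ IsInert π x) ∨
      (¬ IsRamified π x ∧ IsSplit π x ∧ ¬ IsInert π x) ∨
      (¬ IsRamified π x ∧ ¬ IsSplit π x ∧ IsInert π x)) ∧
    (IsRamified π x → localFactor π (π ≫ t) x = (1 - PowerSeries.X ^ pointDegree t x)⁻¹) ∧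
    (IsSplit π x → localFactor π (π ≫ t) x = ((1 - PowerSeries.X ^ pointDegree t x) ^ 2)⁻¹) ∧
    (IsInert π x →
      localFactor π (π ≫ t) x = (1 - PowerSeries.X ^ (2 * pointDegree t x))⁻¹) := by
  have hdeg : ∀ y ∈ closedFiber π x,
      pointDegree (π ≫ t) y = inertiaDegree π y * pointDegree t x := fun y hy => by
    rw [pointDegree_comp, map_eq_of_mem_closedFiber π hy]
  obtain ⟨y, hy, he, hf⟩ | ⟨y, hy, he, hf⟩ | ⟨y, z, hyz, hy, h1, h2⟩ := fiber_cases π hF hsum hpos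
  · have hR : IsRamified π x := ⟨y, by rw [hy]; rfl, by lia⟩
    have hS : ¬ IsSplit π x := fun h => by
      have := (h y (by rw [hy]; rfl)).1
      lia
    have hI : ¬ IsInert π x := fun h => h.1 hR
    refine ⟨Or.inl ⟨hR, hS, hI⟩, fun _ => ?_, fun h => (hS h).elim, fun h => (hI h).elim⟩
    have := hdeg y (by rw [hy]; rfl)
    rw [localFactor, hy, finprod_mem_singleton, this, hf, one_mul]
  · have hR : ¬ IsRamified π x := by
      rintro ⟨z, hz, h⟩
      rw [hy] at hz
      rw [Set.mem_singleton_iff.mp hz] at h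
      lia
    have hS : ¬ IsSplit π x := fun h => by
      have := (h y (by rw [hy]; rfl)).2
      lia
    have hI : IsInert π x := ⟨hR, y, by rw [hy]; rfl, fun z hz => by rw [hy] at hz; exact hz⟩
    refine ⟨Or.inr (Or.inr ⟨hR, hS, hI⟩), fun h => (hR h).elim, fun h => (hS h).elim, fun _ => ?_⟩
    have := hdeg y (by rw [hy]; rfl)
    rw [localFactor, hy, finprod_mem_singleton, this, hf]
  · have hall : ∀ w ∈ closedFiber π x, ramificationIndex π w = 1 ∧ inertiaDegree π w = 1 := by
      intro w hw
      rw [hy] at hw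
      rcases hw with rfl | hw
      · exact h1
      · rw [Set.mem_singleton_iff.mp hw]
        exact h2
    have hR : ¬ IsRamified π x := by
      rintro ⟨w, hw, h⟩
      have := (hall w hw).1
      lia
    have hym : y ∈ closedFiber π x := by rw [hy]; exact Or.inl rfl
    have hzm : z ∈ closedFiber π x := by rw [hy]; exact Or.inr rfl
    have hI : ¬ IsInert π x := fun h => hyz (h.2.unique hym hzm)
    refine ⟨Or.inr (Or.inl ⟨hR, hall, hI⟩), fun h => (hR h).elim, fun _ => ?_,
      fun h => (hI h).elim⟩
    rw [localFactor, hy, finprod_mem_pair hyz, hdeg y hym, hdeg z hzm, h1.2, h2.2, one_mul, sq,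
      PowerSeries.mul_inv_rev]

end QuadraticFiber

/-! ### Integral closures with a basis `1, v` -/

section IntegralClosure

open Polynomial

/-- The elements of `S` that are integral over `R` form a free module with a basis `1, v`. -/
def HasQuadraticIntegralClosure {R S : Type*} [CommRing R] [CommRing S] (ψ : R →+* S) : Prop :=
  ∃ v : S, Function.Injective (fun p : R × R => ψ p.1 + ψ p.2 * v) ∧
    ∀ z, ψ.IsIntegralElem z ↔ ∃ p : R × R, ψ p.1 + ψ p.2 * v = z

theorem isIntegralElem_comp_equiv {R R' S : Type*} [CommRing R] [CommRing R'] [CommRing S]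
    (ψ : R →+* S) (e : R' ≃+* R) {z : S} (h : (ψ.comp e.toRingHom).IsIntegralElem z) :
    ψ.IsIntegralElem z := by
  obtain ⟨P, hP, hz⟩ := h
  exact ⟨P.map e.toRingHom, hP.map _, by rwa [eval₂_map]⟩

theorem HasQuadraticIntegralClosure.of_equiv {R R' S S' : Type*} [CommRing R] [CommRing R']
    [CommRing S] [CommRing S'] {ψ : R →+* S} {ψ' : R' →+* S'} (e : R' ≃+* R) (e' : S' ≃+* S)
    (hcomm : ∀ r, e' (ψ' r) = ψ (e r)) (h : HasQuadraticIntegralClosure ψ) :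
    HasQuadraticIntegralClosure ψ' := by
  obtain ⟨v, hinj, hint⟩ := h
  have hψ : e'.toRingHom.comp ψ' = ψ.comp e.toRingHom := RingHom.ext hcomm
  have key : ∀ p : R' × R', e' (ψ' p.1 + ψ' p.2 * e'.symm v) = ψ (e p.1) + ψ (e p.2) * v := by
    intro p
    rw [map_add, map_mul, hcomm, hcomm, e'.apply_symm_apply]
  refine ⟨e'.symm v, fun p q hpq => ?_, fun z => ⟨fun hz => ?_, ?_⟩⟩
  · have h1 := congrArg e' hpq
    simp only [key] at h1
    have h2 := hinj (a₁ := (e p.1, e p.2)) (a₂ := (e q.1, e q.2)) h1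
    exact Prod.ext (e.injective (congrArg Prod.fst h2)) (e.injective (congrArg Prod.snd h2))
  · have h1 : (e'.toRingHom.comp ψ').IsIntegralElem (e' z) := hz.map e'.toRingHom
    rw [hψ] at h1
    obtain ⟨p, hp⟩ := (hint _).mp (isIntegralElem_comp_equiv ψ e h1)
    refine ⟨(e.symm p.1, e.symm p.2), e'.injective ?_⟩
    rw [key, ← hp]
    simp
  · rintro ⟨p, rfl⟩
    have h1 := (hint _).mpr ⟨(e p.1, e p.2), rfl⟩
    obtain ⟨P, hP, hz⟩ := h1
    refine ⟨P.map e.symm.toRingHom, hP.map _, e'.injective ?_⟩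
    have h2 := hom_eval₂ (P.map e.symm.toRingHom) ψ' e'.toRingHom
      (ψ' p.1 + ψ' p.2 * e'.symm v)
    rw [hψ, eval₂_map (f := e.symm.toRingHom) (g := ψ.comp e.toRingHom),
      RingHom.comp_assoc] at h2
    have h3 : e.toRingHom.comp e.symm.toRingHom = RingHom.id R := by ext; simp
    rw [h3, RingHom.comp_id] at h2
    refine h2.trans ?_
    change eval₂ ψ (e' (ψ' p.1 + ψ' p.2 * e'.symm v)) P = e' 0
    rw [key, map_zero]
    exact hz

/-- A quadratic extension `R[Y] / (Y ^ 2 + h Y - f)` has the basis `1, Y`. -/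
theorem bijective_adjoinRoot_quadratic {R : Type*} [CommRing R] [Nontrivial R] (f h : R) :
    Function.Bijective (fun p : R × R =>
      AdjoinRoot.of (X ^ 2 + C h * X - C f : R[X]) p.1 +
        AdjoinRoot.of (X ^ 2 + C h * X - C f : R[X]) p.2 *
          AdjoinRoot.root (X ^ 2 + C h * X - C f : R[X])) := by
  set Q : R[X] := X ^ 2 + C h * X - C f with hQ
  have hdeg : (C h * X - C f).degree < 2 := by compute_degree!
  have hQ' : Q = X ^ 2 + (C h * X - C f) := by rw [hQ]; ring
  have hm : Q.Monic := by rw [hQ']; exact monic_X_pow_add hdeg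
  have hd : Q.degree = 2 := by
    rw [hQ']
    exact (degree_add_eq_left_of_degree_lt (by rwa [degree_X_pow])).trans (degree_X_pow 2)
  have hmk : ∀ p : R × R, AdjoinRoot.of Q p.1 + AdjoinRoot.of Q p.2 * AdjoinRoot.root Q =
      AdjoinRoot.mk Q (C p.1 + C p.2 * X) := fun p => by simp
  have hlt : ∀ p : R × R, (C p.1 + C p.2 * X : R[X]).degree < 2 := fun p => by compute_degree!
  constructor
  · intro p q hpq
    simp only [hmk] at hpq
    rw [AdjoinRoot.mk_eq_mk] at hpq
    have h0 : (C p.1 + C p.2 * X - (C q.1 + C q.2 * X) : R[X]) = 0 := by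
      by_contra h
      refine hm.not_dvd_of_degree_lt h ?_ hpq
      rw [hd]
      exact (degree_sub_le _ _).trans_lt (max_lt (hlt p) (hlt q))
    have h1 := congrArg (coeff · 0) h0
    have h2 := congrArg (coeff · 1) h0
    simp [coeff_X, coeff_C] at h1 h2
    exact Prod.ext (sub_eq_zero.mp h1) (sub_eq_zero.mp h2)
  · intro z
    obtain ⟨P, rfl⟩ := AdjoinRoot.mk_surjective z
    refine ⟨((P %ₘ Q).coeff 0, (P %ₘ Q).coeff 1), ?_⟩
    refine (hmk _).trans ?_
    have h1 : (P %ₘ Q).degree < 2 := hd ▸ degree_modByMonic_lt P hm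
    have h2 : P %ₘ Q = C ((P %ₘ Q).coeff 0) + C ((P %ₘ Q).coeff 1) * X := by
      have h3 : (P %ₘ Q).degree ≤ 1 := degree_le_iff_coeff_zero _ _ |>.mpr fun m hm =>
        (degree_lt_iff_coeff_zero _ 2).mp h1 m (by exact_mod_cast hm)
      exact (eq_X_add_C_of_degree_le_one h3).trans (add_comm _ _)
    rw [← h2, AdjoinRoot.mk_eq_mk]
    refine ⟨-(P /ₘ Q), ?_⟩
    have := modByMonic_add_div P Q
    linear_combination this

/-- The quotient by a monic polynomial is finite over `R`, so every element is integral. -/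
theorem hasQuadraticIntegralClosure_adjoinRoot {R : Type*} [CommRing R] [Nontrivial R] (f h : R) :
    HasQuadraticIntegralClosure (algebraMap R (AdjoinRoot (X ^ 2 + C h * X - C f : R[X]))) := by
  have hm : (X ^ 2 + C h * X - C f : R[X]).Monic := by
    have h1 : (X ^ 2 + C h * X - C f : R[X]) = X ^ 2 + (C h * X - C f) := by ring
    rw [h1]
    exact monic_X_pow_add (by compute_degree!)
  have hb := bijective_adjoinRoot_quadratic f h
  refine ⟨AdjoinRoot.root _, hb.1, fun z => ⟨fun _ => hb.2 z, fun _ => ?_⟩⟩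
  have := hm.finite_adjoinRoot
  exact (Algebra.IsIntegral.of_finite R _).isIntegral z

variable {k S : Type*} [Field k] [CommRing S] {θ : k[X] →+* S} {v : S} {F H : k[X]}

/-- If `X z = p + q v` with `z` integral over `k[X]` and `v ^ 2 = F - H v`, `X ∣ F`, then `p`
vanishes at `0`. -/
theorem coeff_zero_of_isIntegralElem (hv : v ^ 2 = θ F - θ H * v) (hF : F.coeff 0 = 0)
    (hinj : Function.Injective (fun p : k[X] × k[X] => θ p.1 + θ p.2 * v)) {z : S}
    (hz : θ.IsIntegralElem z) {p q : k[X]} (h : θ X * z = θ p + θ q * v) : p.coeff 0 = 0 := by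
  let Q : k[X][X] := X ^ 2 + C H * X - C F
  have hroot : eval₂ θ v Q = 0 := by simp [Q, hv]
  -- `j` identifies the abstract quadratic algebra with `k[X] + k[X] v`, and `ε` below is evaluation
  -- at the point `X = v = 0`, which satisfies the equation because `F(0) = 0`.
  let j : AdjoinRoot Q →+* S := AdjoinRoot.lift θ v hroot
  have hj : Function.Injective j := by
    rw [injective_iff_map_eq_zero]
    intro b hb
    obtain ⟨r, rfl⟩ := (bijective_adjoinRoot_quadratic F H).2 b
    have h1 : θ r.1 + θ r.2 * v = 0 := by
      simp only [j, map_add, map_mul] at hb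
      rwa [AdjoinRoot.lift_of, AdjoinRoot.lift_of, AdjoinRoot.lift_root] at hb
    have h2 : r = 0 := hinj (a₁ := r) (a₂ := 0) (by simpa using h1)
    simp [h2]
  let ε : AdjoinRoot Q →+* k := AdjoinRoot.lift (evalRingHom 0) 0 (by
    simp [Q, ← coeff_zero_eq_eval_zero, hF])
  let c : AdjoinRoot Q := AdjoinRoot.of Q p + AdjoinRoot.of Q q * AdjoinRoot.root Q
  have hjc : j c = θ X * z := by simp [j, c, h]
  have hεc : ε c = p.coeff 0 := by simp [ε, c, coeff_zero_eq_eval_zero]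
  obtain ⟨P, hP, hPz⟩ := hz
  -- If `z` is a root of the monic `P`, then `X z` is a root of `P.scaleRoots X`, which reduces to
  -- `T ^ deg P` at `X = 0`. Applying `ε` gives `p(0) ^ deg P = 0`.
  have h1 : eval₂ θ (θ X * z) (P.scaleRoots X) = 0 := scaleRoots_eval₂_eq_zero θ hPz
  have h2 : eval₂ (AdjoinRoot.of Q) c (P.scaleRoots X) = 0 := by
    apply hj
    rw [hom_eval₂, map_zero, hjc]
    have : j.comp (AdjoinRoot.of Q) = θ := AdjoinRoot.lift_comp_of hroot
    rwa [this]
  have h3 := congrArg ε h2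
  rw [hom_eval₂, map_zero, hεc] at h3
  have h4 : ε.comp (AdjoinRoot.of Q) = evalRingHom 0 := AdjoinRoot.lift_comp_of _
  rw [h4, ← Polynomial.eval_map] at h3
  have h5 : (P.scaleRoots X).map (evalRingHom 0) = X ^ P.natDegree := by
    ext i
    rw [coeff_map, coeff_scaleRoots, coeff_X_pow]
    rcases lt_trichotomy i P.natDegree with hi | hi | hi
    · simp [hi.ne, show P.natDegree - i ≠ 0 by lia]
    · simp [hi, hP.coeff_natDegree]
    · simp [hi.ne', coeff_eq_zero_of_natDegree_lt hi]
  rw [h5, eval_pow, eval_X] at h3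
  refine pow_eq_zero_iff (n := P.natDegree) ?_ |>.mp h3
  -- If `deg P = 0`, then `P = 1` and `S` would be trivial, against the injectivity of `(p, q) ↦ p +
  -- q v`.
  intro h0
  have : P = 1 := hP.natDegree_eq_zero.mp h0
  rw [this, eval₂_one] at hPz
  have h6 : (1 : k[X]) = 0 :=
    congrArg Prod.fst (hinj (a₁ := (1, 0)) (a₂ := (0, 0)) (by simp [hPz]))
  exact one_ne_zero h6

/-- If `v ^ 2 = X (F - H v)` with `F(0) ≠ 0` then `k[X] + k[X] v` is integrally closed in its
localization at `X`. -/
theorem hasQuadraticIntegralClosure_of_localization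
    (hv : v ^ 2 = θ (X * F) - θ (X * H) * v) (hF : F.coeff 0 ≠ 0) (hX : IsUnit (θ X))
    (hinj : Function.Injective (fun p : k[X] × k[X] => θ p.1 + θ p.2 * v))
    (hloc : ∀ z, ∃ (N : ℕ) (p : k[X] × k[X]), θ X ^ N * z = θ p.1 + θ p.2 * v) :
    HasQuadraticIntegralClosure θ := by
  let := θ.toAlgebra
  have hθ : ∀ p, IsIntegral k[X] (θ p) := fun p => isIntegral_algebraMap (x := p)
  have hvint : IsIntegral k[X] v := by
    refine ⟨X ^ 2 + C (X * H) * X - C (X * F), ?_, ?_⟩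
    · have h1 : (X ^ 2 + C (X * H) * X - C (X * F) : k[X][X]) =
          X ^ 2 + (C (X * H) * X - C (X * F)) := by ring
      rw [h1]
      exact monic_X_pow_add (by compute_degree!)
    · change eval₂ θ v _ = 0
      simp [hv]
  have hspan : ∀ p q : k[X], IsIntegral k[X] (θ p + θ q * v) := fun p q =>
    (hθ p).add ((hθ q).mul hvint)
  -- One factor `X` is removed from the denominator at a time.
  have step : ∀ z, IsIntegral k[X] z → (∃ p q, θ X * z = θ p + θ q * v) →
      ∃ p q, z = θ p + θ q * v := by
    rintro z hz ⟨p, q, h⟩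
    have hp : p.coeff 0 = 0 := coeff_zero_of_isIntegralElem hv (by simp) hinj hz h
    obtain ⟨p₁, rfl⟩ := X_dvd_iff.mpr hp
    have hq := divX_mul_X_add q
    set q₁ := q.divX
    set q₀ := q.coeff 0
    -- Subtracting an element of `k[X] + k[X] v` leaves an integral `w` with `X w = q₀ v`, `q₀`
    -- constant. Squaring and cancelling `X` gives `X w ^ 2 = q₀ ^ 2 (F - H v)`, so `q₀ ^ 2 F(0) =
    -- 0`, that is `q₀ = 0`.
    have hw : IsIntegral k[X] (z - (θ p₁ + θ q₁ * v)) := hz.sub (hspan _ _)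
    set w := z - (θ p₁ + θ q₁ * v) with hwdef
    have h1 : θ X * w = θ (C q₀) * v := by
      rw [hwdef, mul_sub, h, ← hq]
      simp only [map_mul, map_add]
      ring
    have h2 : θ X * w ^ 2 = θ (C q₀ ^ 2 * F) + θ (-(C q₀ ^ 2 * H)) * v := by
      apply hX.mul_left_cancel
      have : θ X * (θ X * w ^ 2) = (θ X * w) ^ 2 := by ring
      rw [this, h1, mul_pow, hv]
      simp only [map_mul, map_pow, map_neg]
      ring
    have h3 := coeff_zero_of_isIntegralElem hv (by simp) hinj (hw.pow 2) h2
    have h4 : q₀ = 0 := by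
      rw [← C_pow, coeff_C_mul] at h3
      simpa [hF] using h3
    rw [h4, C_0, map_zero, zero_mul] at h1
    have h5 : w = 0 := hX.mul_left_cancel (h1.trans (mul_zero _).symm)
    exact ⟨p₁, q₁, sub_eq_zero.mp h5⟩
  refine ⟨v, hinj, fun z => ⟨fun hz => ?_, ?_⟩⟩
  · obtain ⟨N, p, hp⟩ := hloc z
    have h1 : ∀ N, (∃ p q, θ X ^ N * z = θ p + θ q * v) → ∃ p q, z = θ p + θ q * v := by
      intro N
      induction N with
      | zero => simp
      | succ N ih =>
        rintro ⟨p, q, h⟩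
        refine ih (step _ (((hθ X).pow N).mul hz) ⟨p, q, ?_⟩)
        rw [← h, pow_succ]
        ring
    obtain ⟨p, q, h⟩ := h1 N ⟨p.1, p.2, hp⟩
    exact ⟨(p, q), h.symm⟩
  · rintro ⟨p, rfl⟩
    exact hspan p.1 p.2

end IntegralClosure

/-! ### The equation of the curve at infinity -/

section ChartAtInfinity

open Polynomial

variable {k S : Type*} [Field k] [CommRing S] {θ ψ : k[X] →+* S}

/-- `θ` and `ψ` are evaluations at mutually inverse units with the same constants, and reflecting
`p` means passing to `X ^ N p(1 / X)`. -/
theorem map_reflect_of_mul_eq_one (hC : ∀ c, θ (C c) = ψ (C c)) (hX : θ X * ψ X = 1) {p : k[X]}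
    {N : ℕ} (hp : p.natDegree ≤ N) : θ (p.reflect N) = θ X ^ N * ψ p := by
  have hθ : ∀ p, θ p = eval₂ (θ.comp C) (θ X) p := fun p =>
    RingHom.congr_fun (RingHom.ext fun p => by simp [← hom_eval₂] : θ = eval₂RingHom (θ.comp C) (θ X)) p
  have hψ : ∀ p, ψ p = eval₂ (θ.comp C) (ψ X) p := fun p => by
    rw [show θ.comp C = ψ.comp C from RingHom.ext hC, ← hom_eval₂]; simp
  let : Invertible (ψ X) := ⟨θ X, hX, (mul_comm _ _).trans hX⟩
  have h1 := eval₂_reflect_mul_pow (θ.comp C) (ψ X) N p hp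
  change eval₂ (θ.comp C) (θ X) _ * _ = _ at h1
  rw [← hθ, ← hψ] at h1
  rw [← h1, mul_left_comm, ← mul_pow, hX, one_pow, mul_one]

/-- The integral closure of the coordinate ring `k[X]`, `X = x⁻¹`, of the chart at infinity in the
affine coordinate ring of a hyperelliptic curve, localized at `x`. -/
theorem hasQuadraticIntegralClosure_infinity {k S : Type u} [Field k] [CommRing S] {g : ℕ}
    {f h : k[X]} (hf : f.Monic) (hfdeg : f.natDegree = 2 * g + 1) (hhdeg : h.natDegree ≤ g)
    [Algebra (CoordinateRing f h) S]
    [IsLocalization.Away (algebraMap k[X] (CoordinateRing f h) X) S] {θ : k[X] →+* S}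
    (hC : ∀ c, θ (C c) =
      algebraMap (CoordinateRing f h) S (algebraMap k[X] (CoordinateRing f h) (C c)))
    (hX : θ X * algebraMap (CoordinateRing f h) S (algebraMap k[X] (CoordinateRing f h) X) = 1) :
    HasQuadraticIntegralClosure θ := by
  let ι := algebraMap (CoordinateRing f h) S
  let ψ : k[X] →+* S := ι.comp (algebraMap k[X] (CoordinateRing f h))
  let y : CoordinateRing f h := AdjoinRoot.root _
  have hb := bijective_adjoinRoot_quadratic f h
  have hb2 : ∀ a : CoordinateRing f h, ∃ p : k[X] × k[X], a = algebraMap k[X] _ p.1 +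
      algebraMap k[X] _ p.2 * y := fun a => (hb.2 a).imp fun p hp => hp.symm
  have hb1 : ∀ p q : k[X], algebraMap k[X] (CoordinateRing f h) p +
      algebraMap k[X] (CoordinateRing f h) q * y = 0 → p = 0 ∧ q = 0 := fun p q hpq => by
    have := hb.1 (a₁ := (p, q)) (a₂ := (0, 0)) (hpq.trans (by simp))
    exact ⟨congrArg Prod.fst this, congrArg Prod.snd this⟩
  have hι : Function.Injective ι := by
    refine IsLocalization.injective S (M := .powers (algebraMap k[X] (CoordinateRing f h) X)) ?_
    refine Submonoid.powers_le.mpr (mem_nonZeroDivisors_iff_right.mpr fun a ha => ?_)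
    obtain ⟨p, rfl⟩ := hb2 a
    have := hb1 (p.1 * X) (p.2 * X) (by rw [← ha, map_mul, map_mul]; ring)
    simp only [mul_eq_zero, X_ne_zero, or_false] at this
    simp [this.1, this.2]
  have hy : y ^ 2 = algebraMap k[X] _ f - algebraMap k[X] _ h * y := by
    have := AdjoinRoot.eval₂_root (X ^ 2 + C h * X - C f : k[X][X])
    simp only [eval₂_sub, eval₂_add, eval₂_mul, eval₂_X_pow, eval₂_X, eval₂_C] at this
    exact sub_eq_zero.mp (by rw [← this]; simp only [y, AdjoinRoot.algebraMap_eq]; ring)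
  have hrefl := fun {p : k[X]} {N} => map_reflect_of_mul_eq_one (θ := θ) (ψ := ψ) hC hX
    (p := p) (N := N)
  have hu : IsUnit (θ X) := .of_mul_eq_one _ hX
  have hdvd : ∀ {p : k[X]} {N : ℕ}, p.natDegree < N →
      ∃ P, p.reflect N = X * P ∧ P.coeff 0 = p.coeff (N - 1) := by
    intro p N hp
    obtain ⟨P, hP⟩ : X ∣ p.reflect N := X_dvd_iff.mpr (by
      rw [coeff_reflect, revAt_le (Nat.zero_le _), Nat.sub_zero,
        coeff_eq_zero_of_natDegree_lt hp])
    refine ⟨P, hP, ?_⟩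
    rw [← coeff_X_mul P 0, ← hP, coeff_reflect, revAt_le (by lia)]
  -- Since `deg f = 2 g + 1`, reflecting `f` in degree `2 g + 2` leaves exactly one factor `X`, and
  -- `F(0)` is the leading coefficient of `f`. Reflecting `h` in degree `g + 1 > deg h` also leaves
  -- a factor `X`.
  obtain ⟨F, hF, hF0⟩ := hdvd (p := f) (N := 2 * (g + 1)) (by lia)
  obtain ⟨H, hH, -⟩ := hdvd (p := h) (N := g + 1) (by lia)
  refine hasQuadraticIntegralClosure_of_localization (v := θ X ^ (g + 1) * ι y) (F := F) (H := H)
    ?_ ?_ hu ?_ ?_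
  · rw [← hF, ← hH, hrefl (by lia), hrefl (by lia), mul_pow, ← map_pow ι, hy, map_sub, map_mul]
    change _ = _ * ι _ - _ * ι _ * _
    ring
  · rw [hF0, show 2 * (g + 1) - 1 = f.natDegree by lia, hf.coeff_natDegree]
    exact one_ne_zero
  · suffices hs : ∀ p q : k[X], θ p + θ q * (θ X ^ (g + 1) * ι y) = 0 → p = 0 ∧ q = 0 by
      intro p q hpq
      have h1 := hs (p.1 - q.1) (p.2 - q.2) (by
        simp only at hpq
        rw [map_sub, map_sub]
        linear_combination hpq)
      exact Prod.ext (sub_eq_zero.mp h1.1) (sub_eq_zero.mp h1.2)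
    -- A relation in `X` and `v`, cleared of denominators by `x ^ (N + g + 1)`, becomes a relation
    -- between `1` and `y` over `k[x]`.
    intro p q hpq
    obtain ⟨N, hNp, hNq⟩ : ∃ N, p.natDegree ≤ N ∧ q.natDegree ≤ N :=
      ⟨_, le_max_left _ _, le_max_right _ _⟩
    have hinv : ∀ {p : k[X]}, p.natDegree ≤ N → θ p = θ X ^ N * ψ (p.reflect N) := by
      intro p hp
      have h1 : (p.reflect N).natDegree ≤ N := natDegree_le_iff_coeff_eq_zero.mpr fun i hi => by
        rw [coeff_reflect, revAt_eq_self_of_lt hi, coeff_eq_zero_of_natDegree_lt (by lia)]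
      rw [← hrefl h1]
      congr 1
      ext i
      rw [coeff_reflect, coeff_reflect, revAt_invol]
    rw [hinv hNp, hinv hNq] at hpq
    have h1 : θ X ^ (N + (g + 1)) * ι (algebraMap _ _ (p.reflect N * X ^ (g + 1)) +
        algebraMap _ _ (q.reflect N) * y) = 0 := by
      rw [map_add, map_mul, map_mul, map_mul, map_pow, map_pow, pow_add]
      have h2 : θ X ^ (g + 1) * ι (algebraMap k[X] (CoordinateRing f h) X) ^ (g + 1) = 1 := by
        rw [← mul_pow, hX, one_pow]
      change θ X ^ N * ι _ + θ X ^ N * ι _ * _ = 0 at hpq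
      linear_combination hpq + θ X ^ N * ι (algebraMap k[X] (CoordinateRing f h) (p.reflect N)) * h2
    have h2 := (hu.pow (N + (g + 1))).mul_left_cancel (h1.trans (mul_zero _).symm)
    have h3 := hb1 _ _ (hι (h2.trans (map_zero ι).symm))
    rw [mul_eq_zero_iff_right (pow_ne_zero _ X_ne_zero)] at h3
    exact ⟨reflect_eq_zero_iff.mp h3.1, reflect_eq_zero_iff.mp h3.2⟩
  · intro z
    obtain ⟨m, a, ha⟩ := IsLocalization.Away.surj (algebraMap k[X] (CoordinateRing f h) X) z
    obtain ⟨p, rfl⟩ := hb2 a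
    obtain ⟨N, hN1, hN2⟩ : ∃ N, p.1.natDegree ≤ N ∧ p.2.natDegree ≤ N :=
      ⟨_, le_max_left _ _, le_max_right _ _⟩
    have hz : z = θ X ^ m * ι (algebraMap _ _ p.1 + algebraMap _ _ p.2 * y) := by
      rw [← ha, mul_left_comm, ← mul_pow, hX, one_pow, mul_one]
    -- For `z = (p₁ + p₂ y) / x ^ m`, the factor `X ^ N` turns both coefficients into polynomials in
    -- `X`, and `X ^ (g + 1)` turns `y` into `v`.
    refine ⟨N + (g + 1), (X ^ (m + (g + 1)) * p.1.reflect N, X ^ m * p.2.reflect N), ?_⟩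
    simp only [map_mul, map_pow]
    rw [hrefl hN1, hrefl hN2, hz, map_add, map_mul]
    change _ = _ * (_ * ι _) + _ * (_ * ι _) * _
    ring

end ChartAtInfinity

/-! ### The chart rings of the projective line as polynomial rings -/

section ChartRings

open MvPolynomial HomogeneousLocalization

theorem aeval_mul_of_isHomogeneous {k σ T : Type*} [Fintype σ] [CommRing k] [CommRing T]
    [Algebra k T] {a : MvPolynomial σ k} {n : ℕ} (ha : a.IsHomogeneous n) (s : T) (w : σ → T) :
    aeval (fun i => s * w i) a = s ^ n * aeval w a := by
  rw [aeval_def, eval₂_eq', aeval_def, eval₂_eq', Finset.mul_sum]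
  refine Finset.sum_congr rfl fun d hd => ?_
  have h1 : ∑ i, d i = n := by
    rw [← Finsupp.degree_eq_sum]
    exact not_not.mp fun h => mem_support_iff.mp hd (ha.coeff_eq_zero h)
  simp_rw [mul_pow]
  rw [Finset.prod_mul_distrib, Finset.prod_pow_eq_pow_sum, h1]
  ring

variable (k : Type u) [Field k]

theorem X_mem_grading (i : Fin 2) : (X i : MvPolynomial (Fin 2) k) ∈ grading k 1 :=
  isHomogeneous_X k i

/-- The homomorphism from `k[x]` to the ring of the chart `Xᵢ ≠ 0` with `x ↦ Xⱼ / Xᵢ`. -/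
noncomputable def chartCoordinate (i j : Fin 2) : Polynomial k →+* Away (grading k) (X i) :=
  Polynomial.eval₂RingHom ((fromZeroRingHom (grading k) _).comp (algebraMap k (grading k 0)))
    (Away.isLocalizationElem (X_mem_grading k i) (X_mem_grading k j))

theorem chartCoordinate_C (i j : Fin 2) (c : k) : chartCoordinate k i j (Polynomial.C c) =
    fromZeroRingHom (grading k) _ (algebraMap k (grading k 0) c) := by
  simp [chartCoordinate]

theorem chartCoordinate_X (i j : Fin 2) : chartCoordinate k i j Polynomial.X =
    Away.isLocalizationElem (X_mem_grading k i) (X_mem_grading k j) := by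
  simp [chartCoordinate]

theorem val_chartCoordinate_C (i j : Fin 2) (c : k) :
    (chartCoordinate k i j (Polynomial.C c)).val =
      algebraMap (MvPolynomial (Fin 2) k) (Localization.Away (X i : MvPolynomial (Fin 2) k)) (C c) := by
  rw [chartCoordinate_C]
  rfl

theorem mul_val_chartCoordinate_X (i j : Fin 2) :
    algebraMap (MvPolynomial (Fin 2) k) (Localization.Away (X i : MvPolynomial (Fin 2) k)) (X i) *
      (chartCoordinate k i j Polynomial.X).val =
        algebraMap _ _ (X j : MvPolynomial (Fin 2) k) := by
  rw [chartCoordinate_X, Away.val_mk, Localization.mk_eq_mk']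
  simp only [pow_one]
  exact IsLocalization.mk'_spec' (M := .powers (X i : MvPolynomial (Fin 2) k)) _ (X j) ⟨X i, _⟩

variable {k}

/-- Substitute `X_l = X_i · w_l(X_j / X_i)` for each variable and use homogeneity. This gives the
surjectivity of `chartCoordinate`; `dehomogenize` is a left inverse and gives injectivity. -/
theorem algebraMap_eq_pow_mul_val_chartCoordinate {i j : Fin 2} {w : Fin 2 → Polynomial k}
    (hi : w i = 1) (hj : w j = Polynomial.X) (hij : ∀ l, l = i ∨ l = j)
    {a : MvPolynomial (Fin 2) k} {n : ℕ} (ha : a.IsHomogeneous n) :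
    algebraMap _ (Localization.Away (X i : MvPolynomial (Fin 2) k)) a =
      algebraMap (MvPolynomial (Fin 2) k) _ (X i) ^ n * (chartCoordinate k i j (aeval w a)).val := by
  let L := Localization.Away (X i : MvPolynomial (Fin 2) k)
  let V : Polynomial k →+* L := (algebraMap (Away (grading k) (X i)) L).comp (chartCoordinate k i j)
  have h1 : ∀ a : MvPolynomial (Fin 2) k, V (aeval w a) = aeval (fun l => V (w l)) a := by
    refine fun a => RingHom.congr_fun (f := V.comp (aeval w).toRingHom)
      (g := (aeval (R := k) (fun l => V (w l))).toRingHom) (MvPolynomial.ringHom_ext ?_ ?_) a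
    · intro c
      simp only [RingHom.comp_apply, AlgHom.toRingHom_eq_coe, RingHom.coe_coe, aeval_C]
      refine (val_chartCoordinate_C k i j c).trans ?_
      rw [IsScalarTower.algebraMap_apply k (MvPolynomial (Fin 2) k) L]
      rfl
    · intro l
      simp
  refine Eq.trans ?_ (congrArg (_ * ·) (h1 a).symm)
  rw [← aeval_mul_of_isHomogeneous ha]
  have h2 : (fun l => algebraMap (MvPolynomial (Fin 2) k) L (X i) * V (w l)) =
      fun l => algebraMap (MvPolynomial (Fin 2) k) L (X l) := by
    funext l
    rcases hij l with rfl | rfl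
    · rw [hi, map_one, mul_one]
    · rw [hj]
      exact mul_val_chartCoordinate_X k i _
  rw [h2]
  have := aeval_algebraMap_apply (A := MvPolynomial (Fin 2) k) L (X : Fin 2 → _) a
  exact (this.trans (congrArg _ (aeval_X_left_apply a))).symm

/-- Dehomogenization, as a homomorphism on the ring of the chart `Xᵢ ≠ 0`. -/
noncomputable def dehomogenize {i : Fin 2} {w : Fin 2 → Polynomial k} (hi : w i = 1) :
    Away (grading k) (X i) →+* Polynomial k :=
  (IsLocalization.Away.lift (S := Localization.Away (X i : MvPolynomial (Fin 2) k))
    (X i : MvPolynomial (Fin 2) k) (g := (aeval (R := k) w).toRingHom) (by simp [hi])).comp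
  (algebraMap (Away (grading k) (X i)) (Localization.Away (X i : MvPolynomial (Fin 2) k)))

theorem dehomogenize_eq_of_mul_val_eq {i : Fin 2} {w : Fin 2 → Polynomial k} (hi : w i = 1)
    {z : Away (grading k) (X i)} {a : MvPolynomial (Fin 2) k}
    (h : algebraMap (MvPolynomial (Fin 2) k) (Localization.Away (X i : MvPolynomial (Fin 2) k)) (X i) *
      z.val =
      algebraMap _ _ a) : dehomogenize hi z = aeval w a := by
  have h1 := congrArg (IsLocalization.Away.lift
    (S := Localization.Away (X i : MvPolynomial (Fin 2) k)) (X i : MvPolynomial (Fin 2) k)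
    (g := (aeval (R := k) w).toRingHom) (by simp [hi])) h
  rw [map_mul, IsLocalization.Away.lift_eq, IsLocalization.Away.lift_eq] at h1
  simp only [AlgHom.toRingHom_eq_coe, RingHom.coe_coe, aeval_X, hi, one_mul] at h1
  exact h1

theorem dehomogenize_chartCoordinate {i j : Fin 2} {w : Fin 2 → Polynomial k}
    (hi : w i = 1) (hj : w j = Polynomial.X) (p : Polynomial k) :
    dehomogenize hi (chartCoordinate k i j p) = p := by
  refine RingHom.congr_fun (f := (dehomogenize hi).comp (chartCoordinate k i j))
    (g := RingHom.id _) (Polynomial.ringHom_ext ?_ ?_) p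
  · intro c
    refine (dehomogenize_eq_of_mul_val_eq hi (a := X i * C c) ?_).trans ?_
    · rw [val_chartCoordinate_C, map_mul]
    · simp [hi]
  · refine (dehomogenize_eq_of_mul_val_eq hi (mul_val_chartCoordinate_X k i j)).trans ?_
    simp [hj]

theorem bijective_chartCoordinate {i j : Fin 2} {w : Fin 2 → Polynomial k}
    (hi : w i = 1) (hj : w j = Polynomial.X) (hij : ∀ l, l = i ∨ l = j) :
    Function.Bijective (chartCoordinate k i j) := by
  refine ⟨Function.LeftInverse.injective (dehomogenize_chartCoordinate hi hj), fun z => ?_⟩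
  obtain ⟨n, a, ha, rfl⟩ := Away.mk_surjective (grading k) (X_mem_grading k i) z
  refine ⟨aeval w a, val_injective _ ?_⟩
  rw [smul_eq_mul, mul_one] at ha
  have h1 := algebraMap_eq_pow_mul_val_chartCoordinate hi hj hij
    ((mem_homogeneousSubmodule _ _).mp ha)
  rw [Away.val_mk, Localization.mk_eq_mk', eq_comm, IsLocalization.mk'_eq_iff_eq_mul, h1, map_pow,
    mul_comm]

theorem chartRingHom_chartCoordinate (p : Polynomial k) :
    ProjectiveLine.chartRingHom k (chartCoordinate k 1 0 p) = p :=
  dehomogenize_chartCoordinate (w := ![Polynomial.X, 1]) (i := 1) (j := 0) rfl rfl p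

variable (k) in
theorem bijective_chartCoordinate_zero : Function.Bijective (chartCoordinate k 0 1) :=
  bijective_chartCoordinate (w := ![1, Polynomial.X]) rfl rfl (by decide)

variable (k) in
theorem bijective_chartCoordinate_one : Function.Bijective (chartCoordinate k 1 0) :=
  bijective_chartCoordinate (w := ![Polynomial.X, 1]) rfl rfl (by decide)

theorem awayMap_chartCoordinate_C (i j : Fin 2) {x : MvPolynomial (Fin 2) k}
    (hx : x = X i * X j) (c : k) :
    awayMap (grading k) (X_mem_grading k j) hx (chartCoordinate k i j (Polynomial.C c)) =
      fromZeroRingHom (grading k) _ (algebraMap k (grading k 0) c) := by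
  rw [chartCoordinate_C, awayMap_fromZeroRingHom]

theorem awayMap_chartCoordinate_X_mul (i j : Fin 2) {x : MvPolynomial (Fin 2) k}
    (hx : x = X i * X j) (hx' : x = X j * X i) :
    awayMap (grading k) (X_mem_grading k j) hx (chartCoordinate k i j Polynomial.X) *
      awayMap (grading k) (X_mem_grading k i) hx' (chartCoordinate k j i Polynomial.X) = 1 := by
  rw [chartCoordinate_X, chartCoordinate_X]
  refine val_injective _ ?_
  rw [val_mul, awayMap_mk, awayMap_mk, Away.val_mk, Away.val_mk, Localization.mk_mul, val_one,
    ← Localization.mk_one, Localization.mk_eq_mk_iff, Localization.r_iff_exists]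
  refine ⟨1, ?_⟩
  simp only [OneMemClass.coe_one, one_mul, Submonoid.coe_mul, mul_one, pow_one, hx]
  ring

end ChartRings

/-! ### Sections on basic open subsets of `Proj` -/

section Proj

open HomogeneousLocalization

variable {A σ : Type u} [CommRing A] [SetLike σ A] [AddSubgroupClass σ A] (𝒜 : ℕ → σ)
  [GradedRing 𝒜] {m m' : ℕ} {a b x : A}

theorem fromSpec_isAffineOpen_basicOpen (ha : a ∈ 𝒜 m) (hm : 0 < m) :
    (Proj.isAffineOpen_basicOpen 𝒜 a ha hm).fromSpec =
      Spec.map (Proj.awayToSection 𝒜 a) ≫ Proj.awayι 𝒜 a ha hm := by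
  have h1 : (Proj.isAffineOpen_basicOpen 𝒜 a ha hm).isoSpec.hom ≫
      Spec.map (Proj.awayToSection 𝒜 a) = (Proj.basicOpenIsoSpec 𝒜 a ha hm).hom := by
    rw [Proj.basicOpenIsoSpec_hom, IsAffineOpen.isoSpec_hom]
    rfl
  have h2 := (Iso.eq_comp_inv _).mpr ((Iso.inv_comp_eq _).mpr h1.symm)
  rw [Proj.awayι, ← Category.assoc, ← h2]
  rfl

/-- On an open set that maps into `D₊(a b)`, pullbacks from the chart `D₊(a)` can be computed in the
degree zero part of `A[1 / (a b)]`, where both charts are comparable. -/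
theorem appLE_awayToSection {Z : Scheme.{u}} (f : Z ⟶ Proj 𝒜) {V : Z.Opens}
    (hb : b ∈ 𝒜 m') (hx : x = a * b) (hV : V ≤ f ⁻¹ᵁ Proj.basicOpen 𝒜 x)
    (hV' : V ≤ f ⁻¹ᵁ Proj.basicOpen 𝒜 a) (z : Away 𝒜 a) :
    (f.appLE _ V hV').hom ((Proj.awayToSection 𝒜 a).hom z) =
      (f.appLE _ V hV).hom ((Proj.awayToSection 𝒜 x).hom (awayMap 𝒜 hb hx z)) := by
  have h1 := Proj.awayMap_awayToSection_assoc 𝒜 hb hx (f.appLE _ V hV)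
  rw [Scheme.Hom.map_appLE] at h1
  exact (congrArg (fun φ => φ.hom z) h1).symm

end Proj

/-! ### The affine curve over the two charts -/

section Charts

open MvPolynomial HomogeneousLocalization

variable (k : Type u) [Field k]

/-- The open subset `Xᵢ ≠ 0` of the projective line. -/
noncomputable def chartOpen (i : Fin 2) : (ProjectiveLine k).Opens :=
  Proj.basicOpen (grading k) (X i)

theorem isAffineOpen_chartOpen (i : Fin 2) : IsAffineOpen (chartOpen k i) :=
  Proj.isAffineOpen_basicOpen (grading k) (X i) (X_mem_grading k i) Nat.one_pos

theorem fromSpec_chartOpen (i : Fin 2) : (isAffineOpen_chartOpen k i).fromSpec =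
    Spec.map (Proj.awayToSection (grading k) (X i)) ≫
      Proj.awayι (grading k) (X i) (X_mem_grading k i) Nat.one_pos :=
  fromSpec_isAffineOpen_basicOpen (grading k) (X_mem_grading k i) Nat.one_pos

theorem bijective_awayToSection (i : Fin 2) :
    Function.Bijective (Proj.awayToSection (grading k) (X i)).hom :=
  ConcreteCategory.bijective_of_isIso
    (Proj.basicOpenIsoAway (grading k) (X i) (X_mem_grading k i) Nat.one_pos).hom

theorem chartOpen_sup_chartOpen : chartOpen k 0 ⊔ chartOpen k 1 = ⊤ := by
  have := Proj.iSup_basicOpen_eq_top' (grading k) (X : Fin 2 → MvPolynomial (Fin 2) k)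
    (fun i => ⟨1, X_mem_grading k i⟩) (by
      rw [eq_top_iff]
      intro a _
      induction a using MvPolynomial.induction_on with
      | C c => exact Subalgebra.algebraMap_mem _ (algebraMap k (grading k 0) c)
      | add p q hp hq => exact add_mem (hp trivial) (hq trivial)
      | mul_X p i hp => exact mul_mem (hp trivial) (Algebra.subset_adjoin ⟨i, rfl⟩))
  refine le_antisymm le_top (this.ge.trans (iSup_le fun i => ?_))
  fin_cases i
  exacts [le_sup_left, le_sup_right]

/-- The homomorphism from `k[x]` to the sections on the chart `Xᵢ ≠ 0` with `x ↦ Xⱼ / Xᵢ`. -/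
noncomputable def chartSection (i j : Fin 2) :
    Polynomial k →+* Γ(ProjectiveLine k, chartOpen k i) :=
  (Proj.awayToSection (grading k) (X i)).hom.comp (chartCoordinate k i j)

theorem bijective_chartSection_zero : Function.Bijective (chartSection k 0 1) :=
  (bijective_awayToSection k 0).comp (bijective_chartCoordinate_zero k)

theorem bijective_chartSection_one : Function.Bijective (chartSection k 1 0) :=
  (bijective_awayToSection k 1).comp (bijective_chartCoordinate_one k)

theorem isAffineOpen_fromSpec_Spec {R : CommRingCat.{u}} {V : (Spec R).Opens}
    (hV : IsAffineOpen V) : hV.fromSpec =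
      Spec.map ((Scheme.ΓSpecIso R).inv ≫ (Spec R).presheaf.map (homOfLE le_top).op) := by
  rw [← (isAffineOpen_top (Spec R)).map_fromSpec hV (homOfLE le_top).op, Spec.map_comp,
    IsAffineOpen.fromSpec_top, Scheme.isoSpec_Spec_inv]

theorem chartOpen_overlap_C {Z : Scheme.{u}} (f : Z ⟶ ProjectiveLine k) (V : Z.Opens)
    (h0 : V ≤ f ⁻¹ᵁ chartOpen k 0) (h1 : V ≤ f ⁻¹ᵁ chartOpen k 1) :
    (∀ c, (f.appLE _ V h0).hom (chartSection k 0 1 (Polynomial.C c)) =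
      (f.appLE _ V h1).hom (chartSection k 1 0 (Polynomial.C c))) ∧
    (f.appLE _ V h0).hom (chartSection k 0 1 Polynomial.X) *
      (f.appLE _ V h1).hom (chartSection k 1 0 Polynomial.X) = 1 := by
  let x : MvPolynomial (Fin 2) k := X 0 * X 1
  have hx' : x = X 1 * X 0 := mul_comm _ _
  have hV : V ≤ f ⁻¹ᵁ (Proj.basicOpen (grading k) x) := by
    rw [Proj.basicOpen_mul]
    exact le_inf h0 h1
  let ψ : Away (grading k) x →+* Γ(Z, V) :=
    (Scheme.Hom.appLE (Y := ProjectiveLine k) f _ V hV).hom.comp (Proj.awayToSection (grading k) x).hom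
  have e0 : ∀ p, (f.appLE _ V h0).hom (chartSection k 0 1 p) =
      ψ (awayMap (grading k) (X_mem_grading k 1) rfl (chartCoordinate k 0 1 p)) :=  fun p =>
    appLE_awayToSection (grading k) f (X_mem_grading k 1) rfl hV h0 _
  have e1 : ∀ p, (f.appLE _ V h1).hom (chartSection k 1 0 p) =
      ψ (awayMap (grading k) (X_mem_grading k 0) hx' (chartCoordinate k 1 0 p)) := fun p =>
    appLE_awayToSection (grading k) f (X_mem_grading k 0) hx' hV h1 _
  constructor
  · intro c
    rw [e0, e1, awayMap_chartCoordinate_C, awayMap_chartCoordinate_C]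
  · rw [e0, e1, ← map_mul, awayMap_chartCoordinate_X_mul, map_one]

variable {k} (f h : Polynomial k)

/-- The homomorphism from the affine coordinate ring to the sections on an open subset. -/
noncomputable def affineSection (V : (Spec (.of (CoordinateRing f h))).Opens) :
    CoordinateRing f h →+* Γ(Spec (.of (CoordinateRing f h)), V) :=
  ((Scheme.ΓSpecIso _).inv ≫
    (Spec (.of (CoordinateRing f h))).presheaf.map (homOfLE le_top).op).hom

theorem bijective_affineSection {V : (Spec (.of (CoordinateRing f h))).Opens} (hV : V = ⊤) :
    Function.Bijective (affineSection f h V) := by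
  subst hV
  have e : (Scheme.ΓSpecIso (.of (CoordinateRing f h))).inv ≫
      (Spec (.of (CoordinateRing f h))).presheaf.map (homOfLE le_top).op =
      (Scheme.ΓSpecIso (.of (CoordinateRing f h))).inv := by
    rw [show (homOfLE (le_top : (⊤ : (Spec (.of (CoordinateRing f h))).Opens) ≤ ⊤)).op = 𝟙 _ from
      rfl, CategoryTheory.Functor.map_id, Category.comp_id]
  rw [affineSection, e]
  exact ConcreteCategory.bijective_of_isIso _

/-- The coordinate of the chart `X₁ ≠ 0` pulls back to `x`. Both sides describe the restriction of
`affineToLine` to `V`, so they agree after composing with the monomorphism `Proj.awayι`. -/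
theorem appLE_chartSection_one {V : (Spec (.of (CoordinateRing f h))).Opens} (hV : IsAffineOpen V)
    (h1 : V ≤ affineToLine f h ⁻¹ᵁ chartOpen k 1) (p : Polynomial k) :
    ((affineToLine f h).appLE _ V h1).hom (chartSection k 1 0 p) =
      affineSection f h V (algebraMap _ _ p) := by
  have e := (isAffineOpen_chartOpen k 1).SpecMap_appLE_fromSpec (affineToLine f h) hV h1
  rw [fromSpec_chartOpen, isAffineOpen_fromSpec_Spec] at e
  have e2 : Spec.map (Proj.awayToSection (grading k) (X 1) ≫ (affineToLine f h).appLE _ V h1) =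
      Spec.map (CommRingCat.ofHom (ProjectiveLine.chartRingHom k) ≫
        CommRingCat.ofHom (algebraMap (Polynomial k) (CoordinateRing f h)) ≫
        (Scheme.ΓSpecIso _).inv ≫
          (Spec (.of (CoordinateRing f h))).presheaf.map (homOfLE le_top).op) := by
    rw [← cancel_mono (Proj.awayι (grading k) (X 1) (X_mem_grading k 1) Nat.one_pos)]
    refine ((congrArg (· ≫ _) (Spec.map_comp _ _)).trans (Category.assoc _ _ _)).trans
      (e.trans ?_)
    simp only [Spec.map_comp, Category.assoc]
    rfl
  have e3 := congrArg (fun φ => φ.hom (chartCoordinate k 1 0 p)) (Spec.map_injective e2)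
  refine e3.trans ?_
  exact congrArg (fun p => affineSection f h V (algebraMap _ _ p)) (chartRingHom_chartCoordinate p)

theorem affineToLine_preimage_chartOpen_one : affineToLine f h ⁻¹ᵁ chartOpen k 1 = ⊤ := by
  have h1 : Proj.awayι (grading k) (X 1) (X_mem_grading k 1) Nat.one_pos ⁻¹ᵁ
      Proj.basicOpen (grading k) (X 1) = ⊤ := by
    rw [← Proj.opensRange_awayι (grading k) (X 1) (X_mem_grading k 1) Nat.one_pos,
      Scheme.Hom.preimage_opensRange]
  exact congrArg (fun W => Spec.map (CommRingCat.ofHom (algebraMap (Polynomial k)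
    (CoordinateRing f h))) ⁻¹ᵁ Spec.map (CommRingCat.ofHom (ProjectiveLine.chartRingHom k)) ⁻¹ᵁ W) h1

theorem affineToLine_preimage_chartOpen_zero : affineToLine f h ⁻¹ᵁ chartOpen k 0 =
    PrimeSpectrum.basicOpen (algebraMap (Polynomial k) (CoordinateRing f h) Polynomial.X) := by
  have h1 := Proj.awayι_preimage_basicOpen (grading k) (X_mem_grading k 1) Nat.one_pos
    (X_mem_grading k 0) Nat.one_pos
  rw [← chartCoordinate_X] at h1
  refine (congrArg (fun W => Spec.map (CommRingCat.ofHom (algebraMap (Polynomial k)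
    (CoordinateRing f h))) ⁻¹ᵁ
      Spec.map (CommRingCat.ofHom (ProjectiveLine.chartRingHom k)) ⁻¹ᵁ W) h1).trans ?_
  exact congrArg (fun p => PrimeSpectrum.basicOpen (algebraMap (Polynomial k) (CoordinateRing f h) p))
    (chartRingHom_chartCoordinate Polynomial.X)

theorem isLocalization_affineSection (r : CoordinateRing f h)
    {V : (Spec (.of (CoordinateRing f h))).Opens}
    (hV : V = PrimeSpectrum.basicOpen r) :
    @IsLocalization.Away _ _ r Γ(Spec (.of (CoordinateRing f h)), V) _
      (affineSection f h V).toAlgebra := by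
  subst hV
  have h1 : (affineSection f h (PrimeSpectrum.basicOpen r)).toAlgebra =
      StructureSheaf.openAlgebra (CoordinateRing f h) (Opposite.op (PrimeSpectrum.basicOpen r)) :=
    Algebra.algebra_ext _ _ fun a => rfl
  rw [h1]
  exact StructureSheaf.IsLocalization.to_basicOpen (CoordinateRing f h) r

theorem hasQuadraticIntegralClosure_chartOpen_one :
    HasQuadraticIntegralClosure ((affineToLine f h).app (chartOpen k 1)).hom := by
  have hb := bijective_affineSection f h (affineToLine_preimage_chartOpen_one f h)
  refine (hasQuadraticIntegralClosure_adjoinRoot f h).of_equiv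
    (RingEquiv.ofBijective _ (bijective_chartSection_one k)).symm
    (RingEquiv.ofBijective _ hb).symm fun r => ?_
  obtain ⟨p, rfl⟩ := (bijective_chartSection_one k).2 r
  rw [RingEquiv.symm_apply_eq]
  have h2 := (RingEquiv.ofBijective _ (bijective_chartSection_one k)).symm_apply_apply p
  refine Eq.trans ?_ (congrArg (fun p => affineSection f h _ (algebraMap _ _ p)) h2.symm)
  rw [Scheme.Hom.app_eq_appLE]
  exact appLE_chartSection_one f h ((isAffineOpen_chartOpen k 1).preimage _) le_rfl p

/-- The preimage of this chart is the locus `x ≠ 0`, whose ring is the coordinate ring localized at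
`x`. The overlap relation says that the chart coordinate acts there as `1 / x`, so the computation
at infinity applies. -/
theorem hasQuadraticIntegralClosure_chartOpen_zero {g : ℕ} (hf : f.Monic)
    (hfdeg : f.natDegree = 2 * g + 1) (hhdeg : h.natDegree ≤ g) :
    HasQuadraticIntegralClosure ((affineToLine f h).app (chartOpen k 0)).hom := by
  let V := affineToLine f h ⁻¹ᵁ chartOpen k 0
  have hV : IsAffineOpen V := (isAffineOpen_chartOpen k 0).preimage _
  have h1 : V ≤ affineToLine f h ⁻¹ᵁ chartOpen k 1 := by
    rw [affineToLine_preimage_chartOpen_one]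
    exact le_top
  let θ := ((affineToLine f h).app (chartOpen k 0)).hom.comp (chartSection k 0 1)
  have hθ : ∀ p, θ p = ((affineToLine f h).appLE _ V le_rfl).hom (chartSection k 0 1 p) := by
    intro p
    rw [← Scheme.Hom.app_eq_appLE]
    rfl
  obtain ⟨hC, hX⟩ := chartOpen_overlap_C k (affineToLine f h) V le_rfl h1
  let := (affineSection f h V).toAlgebra
  have := isLocalization_affineSection f h _ (affineToLine_preimage_chartOpen_zero f h)
  have key : HasQuadraticIntegralClosure θ := by
    refine hasQuadraticIntegralClosure_infinity hf hfdeg hhdeg (fun c => ?_) ?_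
    · rw [hθ, hC, appLE_chartSection_one f h hV]
      rfl
    · rw [appLE_chartSection_one f h hV, ← hθ] at hX
      exact hX
  refine key.of_equiv (RingEquiv.ofBijective _ (bijective_chartSection_zero k)).symm
    (RingEquiv.refl _) fun r => ?_
  obtain ⟨p, rfl⟩ := (bijective_chartSection_zero k).2 r
  have h2 := (RingEquiv.ofBijective _ (bijective_chartSection_zero k)).symm_apply_apply p
  exact congrArg θ h2.symm

end Charts

/-! ### Finiteness, flatness and rank of the normalization -/

section Normalization

theorem HasQuadraticIntegralClosure.finite_flat_finrank {R S T : Type*} [CommRing R] [CommRing S]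
    [CommRing T] [Nontrivial R] [Algebra R S] (h : HasQuadraticIntegralClosure (algebraMap R S))
    {χ : R →+* T} (e : T ≃+* integralClosure R S)
    (he : ∀ r, e (χ r) = algebraMap R (integralClosure R S) r) :
    χ.Finite ∧ χ.Flat ∧ (letI := χ.toAlgebra; Module.finrank R T = 2) := by
  obtain ⟨v, hinj, hint⟩ := h
  have hv : v ∈ integralClosure R S := (hint v).mpr ⟨(0, 1), by simp⟩
  let := χ.toAlgebra
  let w : T := e.symm ⟨v, hv⟩
  let l : R × R →ₗ[R] T := (Algebra.linearMap R T).coprod (LinearMap.toSpanSingleton R T w)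
  have hl : ∀ p, (e (l p) : S) = algebraMap R S p.1 + algebraMap R S p.2 * v := by
    intro p
    have h1 : l p = χ p.1 + χ p.2 * w := by
      simp only [l, LinearMap.coprod_apply, Algebra.linearMap_apply,
        LinearMap.toSpanSingleton_apply, Algebra.smul_def]
      rfl
    rw [h1, map_add, map_mul, he, he, e.apply_symm_apply]
    rfl
  have hb : Function.Bijective l := by
    refine ⟨fun p q hpq => hinj ?_, fun t => ?_⟩
    · simp only [← hl, hpq]
    · obtain ⟨p, hp⟩ := (hint (e t)).mp (e t).2
      exact ⟨p, e.injective (Subtype.ext ((hl p).trans hp))⟩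
  let L := LinearEquiv.ofBijective l hb
  refine ⟨Module.Finite.equiv L, Module.Flat.of_linearEquiv L.symm, ?_⟩
  rw [← L.finrank_eq]
  simp

/-- Over an affine open, the sections of the normalization are the integral closure of `Γ(Y, U)` in
`Γ(X, f ⁻¹ U)`, which is free on `1, v` by hypothesis. -/
theorem fromNormalization_finite_flat_finrank {X Y : Scheme.{u}} (f : X ⟶ Y) [QuasiCompact f]
    [QuasiSeparated f] {U : Y.Opens} (hU : IsAffineOpen U) [Nontrivial Γ(Y, U)]
    (h : HasQuadraticIntegralClosure (f.app U).hom) :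
    (f.fromNormalization.app U).hom.Finite ∧ (f.fromNormalization.app U).hom.Flat ∧
      (letI := (f.fromNormalization.app U).hom.toAlgebra;
        Module.finrank Γ(Y, U) Γ(f.normalization, f.fromNormalization ⁻¹ᵁ U) = 2) := by
  let := (f.app U).hom.toAlgebra
  refine HasQuadraticIntegralClosure.finite_flat_finrank h
    (f.normalizationObjIso hU).commRingCatIsoToRingEquiv fun r => ?_
  have h1 := f.fromNormalization_app hU
  rw [Iso.eq_comp_inv] at h1
  exact congrArg (fun φ => φ.hom r) h1

theorem isFinite_of_iSup_eq_top {X Y : Scheme.{u}} (f : X ⟶ Y) [IsAffineHom f] {ι : Type*}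
    (U : ι → Y.affineOpens) (hU : ⨆ i, (U i : Y.Opens) = ⊤)
    (H : ∀ i, (f.app (U i)).hom.Finite) : IsFinite f := by
  have hloc : HasAffineProperty (@IsFinite : MorphismProperty Scheme.{u}) _ :=
    IsFinite.instHasAffinePropertyAndIsAffineFiniteCarrierObjOppositeOpensCarrierCarrierCommRingCatPresheafOpOpensTopHomAppTop.{u}
  refine (hloc.iff_of_iSup_eq_top U hU).mpr fun i => ⟨(U i).2.preimage f, ?_⟩
  -- The restricted morphism on global sections involves the image of `⊤` under `ι`, which equals `U
  -- i` only propositionally.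
  have h1 : ∀ V, V = (U i).1 → (f.app V).hom.Finite := by
    rintro _ rfl
    exact H i
  rw [morphismRestrict_appTop]
  exact RingHom.Finite.comp (RingHom.Finite.of_surjective _
    (ConcreteCategory.bijective_of_isIso (X.presheaf.map (eqToHom _).op)).2)
    (h1 _ (Scheme.Opens.ι_image_top _))

end Normalization

/-! ### The hyperelliptic curve and its zeta function -/

section Curve

variable {k : Type u} [Field k]

theorem isDomain_chartOpen {i j : Fin 2} (h : Function.Bijective (chartSection k i j)) :
    IsDomain Γ(ProjectiveLine k, chartOpen k i) :=
  (RingEquiv.ofBijective _ h).symm.toMulEquiv.isDomain _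

theorem exists_mem_chartOpen (x : ProjectiveLine k) : x ∈ chartOpen k 0 ∨ x ∈ chartOpen k 1 := by
  have h : x ∈ chartOpen k 0 ⊔ chartOpen k 1 := chartOpen_sup_chartOpen k ▸ trivial
  exact h

variable {f h : Polynomial k} {g : ℕ} (hf : f.Monic) (hfdeg : f.natDegree = 2 * g + 1)
  (hhdeg : h.natDegree ≤ g)

instance : IsIntegralHom (HyperellipticCurve.cover f h) :=
  inferInstanceAs (IsIntegralHom (affineToLine f h).fromNormalization)

include hf hfdeg hhdeg in
/-- The double cover is finite flat of rank two over the standard charts of the projective line. -/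
theorem exists_cover_finite_flat_finrank (i : Fin 2) :
    IsDomain Γ(ProjectiveLine k, chartOpen k i) ∧
    ((HyperellipticCurve.cover f h).app (chartOpen k i)).hom.Finite ∧
    ((HyperellipticCurve.cover f h).app (chartOpen k i)).hom.Flat ∧
    (letI := ((HyperellipticCurve.cover f h).app (chartOpen k i)).hom.toAlgebra;
      Module.finrank Γ(ProjectiveLine k, chartOpen k i)
        Γ(HyperellipticCurve f h, HyperellipticCurve.cover f h ⁻¹ᵁ chartOpen k i) = 2) := by
  have hq : IsDomain Γ(ProjectiveLine k, chartOpen k i) ∧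
      HasQuadraticIntegralClosure ((affineToLine f h).app (chartOpen k i)).hom := by
    fin_cases i
    · exact ⟨isDomain_chartOpen (bijective_chartSection_zero k),
        hasQuadraticIntegralClosure_chartOpen_zero f h hf hfdeg hhdeg⟩
    · exact ⟨isDomain_chartOpen (bijective_chartSection_one k),
        hasQuadraticIntegralClosure_chartOpen_one f h⟩
  have := hq.1
  exact ⟨hq.1, fromNormalization_finite_flat_finrank (affineToLine f h)
    (isAffineOpen_chartOpen k i) hq.2⟩

include hf hfdeg hhdeg in
-- Finiteness makes `C` locally of finite type over `k`, as the Euler product requires.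
theorem isFinite_cover : IsFinite (HyperellipticCurve.cover f h) := by
  have hc : ⨆ i : Fin 2, chartOpen k i = ⊤ := by
    refine le_antisymm le_top ((chartOpen_sup_chartOpen k).ge.trans
      (sup_le (le_iSup _ 0) (le_iSup _ 1)))
  exact isFinite_of_iSup_eq_top _ (fun i => ⟨chartOpen k i, isAffineOpen_chartOpen k i⟩) hc
    fun i => (exists_cover_finite_flat_finrank hf hfdeg hhdeg i).2.1

variable (k) in
theorem surjective_algebraMap_grading_zero : Function.Surjective (algebraMap k (grading k 0)) := by
  rintro ⟨a, ha⟩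
  obtain ⟨c, rfl⟩ : ∃ c, a = MvPolynomial.C c :=
    ⟨_, MvPolynomial.totalDegree_eq_zero_iff_eq_C.mp
      (Nat.le_zero.mp ((MvPolynomial.mem_homogeneousSubmodule _ _).mp ha).totalDegree_le)⟩
  exact ⟨c, rfl⟩

instance : Algebra.FiniteType (grading k 0) (MvPolynomial (Fin 2) k) :=
  have : IsScalarTower k (grading k 0) (MvPolynomial (Fin 2) k) := ⟨fun c a b => by
    change (c • (a : MvPolynomial (Fin 2) k)) * b = c • ((a : MvPolynomial (Fin 2) k) * b)
    exact smul_mul_assoc _ _ _⟩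
  Algebra.FiniteType.of_restrictScalars_finiteType k _ _

instance : LocallyOfFiniteType (ProjectiveLine.structureMap k) := by
  have : LocallyOfFiniteType (Spec.map (CommRingCat.ofHom (algebraMap k (grading k 0)))) :=
    (HasRingHomProperty.Spec_iff (P := @LocallyOfFiniteType)).mpr
      (RingHom.FiniteType.of_surjective _ (surjective_algebraMap_grading_zero k))
  exact inferInstanceAs (LocallyOfFiniteType (Proj.toSpecZero (grading k) ≫
    Spec.map (CommRingCat.ofHom (algebraMap k (grading k 0)))))

instance : CompactSpace (ProjectiveLine k) := by
  have : QuasiCompact (ProjectiveLine.structureMap k) := inferInstanceAs (QuasiCompact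
    (Proj.toSpecZero (grading k) ≫ Spec.map (CommRingCat.ofHom (algebraMap k (grading k 0)))))
  exact QuasiCompact.compactSpace_of_compactSpace (ProjectiveLine.structureMap k)

instance : CompactSpace (HyperellipticCurve f h) :=
  QuasiCompact.compactSpace_of_compactSpace (HyperellipticCurve.cover f h)

include hf hfdeg hhdeg in
theorem locallyOfFiniteType_structureMap :
    LocallyOfFiniteType (HyperellipticCurve.structureMap f h) :=
  have := isFinite_cover hf hfdeg hhdeg
  inferInstanceAs (LocallyOfFiniteType
    (HyperellipticCurve.cover f h ≫ ProjectiveLine.structureMap k))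

include hf hfdeg hhdeg in
theorem exists_closedFiber_sum_eq_two {x : ProjectiveLine k}
    (hx : x ∈ closedPoints (ProjectiveLine k)) :
    ∃ F : Finset (HyperellipticCurve f h), closedFiber (HyperellipticCurve.cover f h) x = F ∧
      ∑ y ∈ F, ramificationIndex (HyperellipticCurve.cover f h) y *
        inertiaDegree (HyperellipticCurve.cover f h) y = 2 ∧
      ∀ y ∈ F, 1 ≤ ramificationIndex (HyperellipticCurve.cover f h) y ∧
        1 ≤ inertiaDegree (HyperellipticCurve.cover f h) y := by
  have key : ∀ i, x ∈ chartOpen k i → _ := fun i hi => by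
    obtain ⟨hdom, hfin, hflat, hrank⟩ := exists_cover_finite_flat_finrank hf hfdeg hhdeg i
    exact exists_fiber_sum_ramificationIndex_mul_inertiaDegree (HyperellipticCurve.cover f h)
      (isAffineOpen_chartOpen k i) hi hx hfin hflat hrank
  exact (exists_mem_chartOpen x).elim (key 0) (key 1)

include hf hfdeg hhdeg in
theorem hasFormalProd_localFactor [Finite k] : HasFormalProd
    (fun x : closedPoints (ProjectiveLine k) =>
      localFactor (HyperellipticCurve.cover f h) (HyperellipticCurve.structureMap f h) x.1)
    (zetaFunction (HyperellipticCurve.structureMap f h)) := by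
  have := locallyOfFiniteType_structureMap hf hfdeg hhdeg
  -- The cover is integral, hence a closed map, so closed points go to closed points and the Euler
  -- product of `C` can be grouped along `p`.
  let p : closedPoints (HyperellipticCurve f h) → closedPoints (ProjectiveLine k) := fun y =>
    ⟨HyperellipticCurve.cover f h y.1, by
      have h1 := (HyperellipticCurve.cover f h).isClosedMap _ y.2
      rwa [Set.image_singleton] at h1⟩
  have hfib : ∀ x, Subtype.val '' (p ⁻¹' {x}) =
      closedFiber (HyperellipticCurve.cover f h) x.1 := by
    intro x
    ext y
    constructor
    · rintro ⟨y, hy, rfl⟩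
      exact ⟨y.2, congrArg Subtype.val hy⟩
    · rintro ⟨hy, hyx⟩
      exact ⟨⟨y, hy⟩, Subtype.ext hyx, rfl⟩
  have hfin : ∀ x, (p ⁻¹' {x}).Finite := by
    intro x
    obtain ⟨F, hF, -⟩ := exists_closedFiber_sum_eq_two hf hfdeg hhdeg x.2
    refine Set.Finite.of_finite_image (f := Subtype.val) ?_ Subtype.val_injective.injOn
    rw [hfib, hF]
    exact F.finite_toSet
  have h1 := (hasFormalProd_zetaFunction (HyperellipticCurve.structureMap f h)).of_fibers p hfin
  convert h1 using 2 with x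
  rw [localFactor, ← hfib, finprod_mem_image Subtype.val_injective.injOn]

end Curve
end HyperellipticZeta

open HyperellipticZeta in
theorem proposition2p2 {k : Type u} [Field k] [Finite k] (g : ℕ) (hg : 1 ≤ g)
    (f h : Polynomial k) (hf : f.Monic) (hfdeg : f.natDegree = 2 * g + 1)
    (hhdeg : h.natDegree ≤ g) (hsmooth : Algebra.Smooth k (CoordinateRing f h)) :
    HasFormalProd
      (fun x : closedPoints (ProjectiveLine k) =>
        localFactor (HyperellipticCurve.cover f h) (HyperellipticCurve.structureMap f h) x.1)
      (zetaFunction (HyperellipticCurve.structureMap f h)) ∧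
    ∀ x ∈ closedPoints (ProjectiveLine k),
      ((IsRamified (HyperellipticCurve.cover f h) x ∧
          ¬ IsSplit (HyperellipticCurve.cover f h) x ∧
          ¬ IsInert (HyperellipticCurve.cover f h) x) ∨
        (¬ IsRamified (HyperellipticCurve.cover f h) x ∧
          IsSplit (HyperellipticCurve.cover f h) x ∧
          ¬ IsInert (HyperellipticCurve.cover f h) x) ∨
        (¬ IsRamified (HyperellipticCurve.cover f h) x ∧
          ¬ IsSplit (HyperellipticCurve.cover f h) x ∧
          IsInert (HyperellipticCurve.cover f h) x)) ∧
      (IsRamified (HyperellipticCurve.cover f h) x →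
        localFactor (HyperellipticCurve.cover f h) (HyperellipticCurve.structureMap f h) x =
          (1 - PowerSeries.X ^ pointDegree (ProjectiveLine.structureMap k) x)⁻¹) ∧
      (IsSplit (HyperellipticCurve.cover f h) x →
        localFactor (HyperellipticCurve.cover f h) (HyperellipticCurve.structureMap f h) x =
          ((1 - PowerSeries.X ^ pointDegree (ProjectiveLine.structureMap k) x) ^ 2)⁻¹) ∧
      (IsInert (HyperellipticCurve.cover f h) x →
        localFactor (HyperellipticCurve.cover f h) (HyperellipticCurve.structureMap f h) x =
          (1 - PowerSeries.X ^ (2 * pointDegree (ProjectiveLine.structureMap k) x))⁻¹) := by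
  refine ⟨hasFormalProd_localFactor hf hfdeg hhdeg, fun x hx => ?_⟩
  obtain ⟨F, hF, hsum, hpos⟩ := exists_closedFiber_sum_eq_two hf hfdeg hhdeg hx
  exact splitting_of_fiber _ _ hF hsum hpos
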